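/- Let $M$ be a finite-dimensional smooth Riemannian manifold, possibly with boundary, let $X$ be a $C^1$ vector field on $M$ generating a flow $X_t$ (defined for all $t\ge 0$, with $X_{-t}$ the inverse of $X_t$), and let $\Gamma\subset M$ be a compact invariant set, $X_t(\Gamma)=\Gamma$ for all $t\in\mathbb R$. Let $T_\Gamma M=E\oplus F$ be a continuous $DX_t$-invariant splitting with $\dim F_x=k\ge 1$ for all $x\in\Gamma$. Give $\wedge^kTM$ the norm induced by the metric, via $\langle u_1\wedge\dots\wedge u_k,v_1\wedge\dots\wedge v_k\rangle=\det(\langle u_i,v_j\rangle)$. Let $\widetilde F=\wedge^kF$, and let $\widetilde E$ be the span of the products $v_1\wedge\dots\wedge v_k$ in which each $v_i$ lies in $E$ or in $F$ and at least one $v_i$ lies in $E$; thus $\wedge^kT_\Gamma M=\widetilde E\oplus\widetilde F$. For $A_t=DX_t$ or $A_t=\wedge^kDX_t$, a splitting $G=E'\oplus F'$ of the corresponding bundle over $\Gamma$ is called *dominated* if it is continuous and $A_t$-invariant, $E'_x\ne 0\ne F'_x$, and there are $K,\lambda>0$ with $\|A_t|_{E'_x}\|\cdot\|A_{-t}|_{F'_{X_t(x)}}\|<Ke^{-\lambda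 t}$ for all $x\in\Gamma$, $t>0$. The subbundle $E'$ is *uniformly contracted* if $\|A_t|_{E'_x}\|\le Ce^{-\lambda t}$, and $F'$ is *uniformly expanded* if $\|(A_t|_{F'_x})^{-1}\|\le Ce^{-\lambda t}$, for some $C,\lambda>0$ and all $x\in\Gamma$, $t\ge0$. The splitting is *partially hyperbolic* if it is dominated and $E'$ is uniformly contracted or $F'$ is uniformly expanded. The subbundle $F$ is *volume expanding* if $|\det(DX_t|_{F_x})|>Ce^{\lambda t}$ for some $C,\lambda>0$ and all $x\in\Gamma$, $t>0$. Finally, $E\oplus F$ is *singular hyperbolic* if it is dominated, $E$ is uniformly contracted and $F$ is volume expanding. Then: (1) $F$ is volume expanding under $DX_t$ if and only if the line bundle $\widetilde F=\wedge^kF$ is uniformly expanded by $\wedge^kDX_t$. (2) If $E$ is uniformly contracted by $DX_t$, then $E\oplus F$ is a singular hyperbolic splitting for $DX_t$ if and only if $\widetilde E\oplus\widetilde F$ is a partially hyperbolic splitting for $\wedge^kDX_t$ with $\widetilde F$ uniformly expanded by $\wedge^kDX_t$. -/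

import Mathlib

open Set Manifold Bundle Topology ContDiff

noncomputable section

/-! ### Linear algebra -/

/-- The operator norm of the restriction of `A` to the subspace `S`. -/
def restrictNorm {V W : Type*} [NormedAddCommGroup V] [NormedSpace ℝ V] [FiniteDimensional ℝ V]
    [NormedAddCommGroup W] [NormedSpace ℝ W] (A : V →ₗ[ℝ] W) (S : Submodule ℝ V) : ℝ :=
  ‖LinearMap.toContinuousLinearMap (A ∘ₗ S.subtype)‖

/-- `|det (A|S)|`: the volume of the parallelepiped spanned by the images under `A` of the vectors
of an orthonormal basis of `S`. -/
def absDetOn {V W : Type*} [NormedAddCommGroup V] [InnerProductSpace ℝ V] [FiniteDimensional ℝ V]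
    [NormedAddCommGroup W] [InnerProductSpace ℝ W] (A : V →ₗ[ℝ] W) (S : Submodule ℝ V) : ℝ :=
  Real.sqrt (Matrix.gram ℝ (fun i => A (stdOrthonormalBasis ℝ S i : V))).det

/-- The subspace `⋀^k F` of `⋀^k V`, spanned by the `f₁ ∧ ⋯ ∧ f_k` with all `f_i ∈ F`. -/
def wedgeSub {V : Type*} [AddCommGroup V] [Module ℝ V] (k : ℕ) (F : Submodule ℝ V) :
    Submodule ℝ (⋀[ℝ]^k V) :=
  Submodule.span ℝ {w | ∃ v : Fin k → V, (∀ i, v i ∈ F) ∧ w = exteriorPower.ιMulti ℝ k v}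

/-- The subspace of `⋀^k V` spanned by the exterior products of vectors of `E` and of `F`, with at
least one factor in `E`. -/
def mixedSub {V : Type*} [AddCommGroup V] [Module ℝ V] (k : ℕ) (E F : Submodule ℝ V) :
    Submodule ℝ (⋀[ℝ]^k V) :=
  Submodule.span ℝ {w | ∃ v : Fin k → V, (∀ i, v i ∈ E ∨ v i ∈ F) ∧ (∃ i, v i ∈ E) ∧
    w = exteriorPower.ιMulti ℝ k v}

/-! ### Linear cocycles over a flow

`φ` is the flow on the base `M`, `G` is a vector bundle over `M`, and
`A t x : G x → G (φ t x)` is the cocycle. The predicate `IsCont W s` says that `s` is a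
continuous section of `G` over the subset `W` of `M`. -/

/-- The family of subspaces `S x` of `G x`, `x ∈ Γ`, is a continuous subbundle over `Γ`: locally it
is spanned by a frame of continuous sections. -/
def IsContSubbundle {M : Type*} [TopologicalSpace M] {G : M → Type*}
    [∀ x, AddCommGroup (G x)] [∀ x, Module ℝ (G x)]
    (IsCont : Set M → (∀ x, G x) → Prop) (Γ : Set M) (S : ∀ x, Submodule ℝ (G x)) : Prop :=
  ∀ x₀ ∈ Γ, ∃ U ∈ 𝓝 x₀, ∃ (d : ℕ) (s : Fin d → ∀ x, G x),
    (∀ i, IsCont (U ∩ Γ) (s i)) ∧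
    ∀ x ∈ U ∩ Γ, LinearIndependent ℝ (fun i => s i x) ∧
      Submodule.span ℝ (range fun i => s i x) = S x

/-- `E ⊕ F` is a continuous `A`-invariant splitting of the bundle `G` over `Γ`. -/
structure IsInvariantSplitting {M : Type*} [TopologicalSpace M] {G : M → Type*}
    [∀ x, AddCommGroup (G x)] [∀ x, Module ℝ (G x)]
    (IsCont : Set M → (∀ x, G x) → Prop) (φ : ℝ → M → M)
    (A : ∀ (t : ℝ) (x : M), G x →ₗ[ℝ] G (φ t x)) (Γ : Set M)
    (E F : ∀ x, Submodule ℝ (G x)) : Prop where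
  isCompl : ∀ x ∈ Γ, IsCompl (E x) (F x)
  continuous_left : IsContSubbundle IsCont Γ E
  continuous_right : IsContSubbundle IsCont Γ F
  map_left : ∀ x ∈ Γ, ∀ t : ℝ, (E x).map (A t x) = E (φ t x)
  map_right : ∀ x ∈ Γ, ∀ t : ℝ, (F x).map (A t x) = F (φ t x)

section Cocycle

variable {M : Type*} {G : M → Type*}
  [∀ x, NormedAddCommGroup (G x)] [∀ x, InnerProductSpace ℝ (G x)]
  [∀ x, FiniteDimensional ℝ (G x)]

/-- `E ⊕ F` is a dominated splitting over `Γ` for the cocycle `A`. -/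
structure IsDominatedSplitting [TopologicalSpace M]
    (IsCont : Set M → (∀ x, G x) → Prop) (φ : ℝ → M → M)
    (A : ∀ (t : ℝ) (x : M), G x →ₗ[ℝ] G (φ t x)) (Γ : Set M)
    (E F : ∀ x, Submodule ℝ (G x)) : Prop extends
    IsInvariantSplitting IsCont φ A Γ E F where
  left_ne_bot : ∀ x ∈ Γ, E x ≠ ⊥
  right_ne_bot : ∀ x ∈ Γ, F x ≠ ⊥
  dominated : ∃ K > 0, ∃ lam > 0, ∀ x ∈ Γ, ∀ t : ℝ, 0 < t →
    restrictNorm (A t x) (E x) * restrictNorm (A (-t) (φ t x)) (F (φ t x))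
      < K * Real.exp (-lam * t)

/-- `E` is uniformly contracted by `A`. -/
def UniformlyContracted (φ : ℝ → M → M)
    (A : ∀ (t : ℝ) (x : M), G x →ₗ[ℝ] G (φ t x)) (Γ : Set M)
    (E : ∀ x, Submodule ℝ (G x)) : Prop :=
  ∃ C > 0, ∃ lam > 0, ∀ x ∈ Γ, ∀ t : ℝ, 0 ≤ t →
    restrictNorm (A t x) (E x) ≤ C * Real.exp (-lam * t)

/-- `F` is uniformly expanded by `A`: the inverse `A (-t) (φ t x)` of `A t x`, restricted
to `F (φ t x)`, has norm at most `C * exp (-lam * t)`. -/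
def UniformlyExpanded (φ : ℝ → M → M)
    (A : ∀ (t : ℝ) (x : M), G x →ₗ[ℝ] G (φ t x)) (Γ : Set M)
    (F : ∀ x, Submodule ℝ (G x)) : Prop :=
  ∃ C > 0, ∃ lam > 0, ∀ x ∈ Γ, ∀ t : ℝ, 0 ≤ t →
    restrictNorm (A (-t) (φ t x)) (F (φ t x)) ≤ C * Real.exp (-lam * t)

/-- `F` is volume expanding under `A`. -/
def VolumeExpanding (φ : ℝ → M → M)
    (A : ∀ (t : ℝ) (x : M), G x →ₗ[ℝ] G (φ t x)) (Γ : Set M)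
    (F : ∀ x, Submodule ℝ (G x)) : Prop :=
  ∃ C > 0, ∃ lam > 0, ∀ x ∈ Γ, ∀ t : ℝ, 0 < t →
    C * Real.exp (lam * t) < absDetOn (A t x) (F x)

/-- `E ⊕ F` is a partially hyperbolic splitting: it is dominated, and `E` is uniformly contracted
or `F` is uniformly expanded. -/
def IsPartiallyHyperbolic [TopologicalSpace M]
    (IsCont : Set M → (∀ x, G x) → Prop) (φ : ℝ → M → M)
    (A : ∀ (t : ℝ) (x : M), G x →ₗ[ℝ] G (φ t x)) (Γ : Set M)
    (E F : ∀ x, Submodule ℝ (G x)) : Prop :=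
  IsDominatedSplitting IsCont φ A Γ E F ∧
    (UniformlyContracted φ A Γ E ∨ UniformlyExpanded φ A Γ F)

/-- `E ⊕ F` is a singular hyperbolic splitting: it is dominated, `E` is uniformly contracted and
the central subbundle `F` is volume expanding. -/
def IsSingularHyperbolic [TopologicalSpace M]
    (IsCont : Set M → (∀ x, G x) → Prop) (φ : ℝ → M → M)
    (A : ∀ (t : ℝ) (x : M), G x →ₗ[ℝ] G (φ t x)) (Γ : Set M)
    (E F : ∀ x, Submodule ℝ (G x)) : Prop :=
  IsDominatedSplitting IsCont φ A Γ E F ∧ UniformlyContracted φ A Γ E ∧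
    VolumeExpanding φ A Γ F

end Cocycle

/-! ### The flow of a vector field and its derivative -/

section Flow

variable {V : Type*} [NormedAddCommGroup V] [NormedSpace ℝ V]
  {H : Type*} [TopologicalSpace H] (I : ModelWithCorners ℝ V H)
  {M : Type*} [TopologicalSpace M] [ChartedSpace H M]

instance finiteDimensional_tangentSpace [FiniteDimensional ℝ V] (x : M) : FiniteDimensional ℝ (TangentSpace I x) :=
  inferInstanceAs (FiniteDimensional ℝ V)

/-- `φ` is the flow generated by `X`: for each `x` the curve `t ↦ φ t x`, `t ≥ 0`, is the integral
curve of `X` starting at `x`, and `φ (-t)` inverts `φ t`. (On a manifold with boundary `φ t` need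
not be onto when `t > 0`, and then `φ (-t)` is meaningful only on the image of `φ t`.) -/
structure IsFlowOf (X : ∀ x : M, TangentSpace I x) (φ : ℝ → M → M) : Prop where
  zero : ∀ x, φ 0 x = x
  integralCurve : ∀ x, IsMIntegralCurveOn (fun t => φ t x) X (Ici (0 : ℝ))
  neg_apply : ∀ t, 0 ≤ t → ∀ x, φ (-t) (φ t x) = x

/-- The derivative cocycle `DX_t` on the tangent bundle. -/
def derivCocycle (φ : ℝ → M → M) (t : ℝ) (x : M) :
    TangentSpace I x →ₗ[ℝ] TangentSpace I (φ t x) :=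
  (mfderiv I I (φ t) x).toLinearMap

/-- The cocycle `⋀^k DX_t` on the `k`-th exterior power of the tangent bundle. -/
def wedgeCocycle (k : ℕ) (φ : ℝ → M → M) (t : ℝ) (x : M) :
    ⋀[ℝ]^k (TangentSpace I x) →ₗ[ℝ] ⋀[ℝ]^k (TangentSpace I (φ t x)) :=
  exteriorPower.map k (derivCocycle I φ t x)

/-- `s` is a continuous section of the tangent bundle over `W`. -/
def IsContVectorField [IsManifold I 1 M] (W : Set M) (s : ∀ x : M, TangentSpace I x) : Prop :=
  ContinuousOn (fun x => (⟨x, s x⟩ : TangentBundle I M)) W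

/-- `w` is a continuous section over `W` of the `k`-th exterior power of the tangent bundle: in the
local trivializations of `⋀^k TM` induced by those of `TM`, its coordinates are continuous. -/
def IsContMultivectorField [IsManifold I 1 M] (k : ℕ) (W : Set M)
    (w : ∀ x : M, ⋀[ℝ]^k (TangentSpace I x)) : Prop :=
  ∀ x₀ ∈ W, ∀ ℓ : ⋀[ℝ]^k V →ₗ[ℝ] ℝ,
    ContinuousWithinAt (fun x => ℓ (exteriorPower.map k
      ((trivializationAt V (fun y : M => TangentSpace I y) x₀).linearMapAt ℝ x) (w x))) W x₀

end Flow

end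

/-! Write T = DX_t at x and S = DX_{-t} at X_t(x), so that S inverts T in the sense that `S ∘ T`
preserves norms. If f₁, …, f_k is an orthonormal basis of F, the line ⋀^k F is spanned by the unit
vector f₁ ∧ ⋯ ∧ f_k, whose image under ⋀^k T has norm |det T|F|. Hence the norm of ⋀^k S on ⋀^k (T
F) is the reciprocal of |det T|F| (`restrictNorm_wedgeSub_mul_absDetOn`), and (1) follows.

Given (1) and the contraction of E, (2) amounts to the equivalence of the two dominations. Choose
the f_i so that the T f_i are orthogonal; then |det T|F| = ∏ ‖T f_i‖. With α = ‖T|E‖ and β = ‖S|TF‖,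
every ‖T f_i‖ is at least 1/β. A basis vector of the mixed subspace arises from f₁ ∧ ⋯ ∧ f_k by
exchanging a ≥ 1 factors for vectors of E, and each exchange multiplies the bound on its image by at
most αβ; so domination passes to ⋀^k (`restrictNorm_mixedSub_mul_le`). Conversely, exchanging only
the factor with the smallest ‖T f_i‖ for e ∈ E recovers αβ up to a constant
(`restrictNorm_mul_le_mixedSub`). The constants depend on x only through the angle between E and F,
which compactness of Γ bounds below (`exists_angle_bound`). -/

section Algebra

variable {V W : Type*} [AddCommGroup V] [Module ℝ V] [AddCommGroup W] [Module ℝ W]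

/-! ### Exterior products of subspaces -/

theorem map_wedgeSub (T : V →ₗ[ℝ] W) (k : ℕ) (F : Submodule ℝ V) :
    (wedgeSub k F).map (exteriorPower.map k T) = wedgeSub k (F.map T) := by
  rw [wedgeSub, wedgeSub, Submodule.map_span]
  congr 1
  ext w
  constructor
  · rintro ⟨_, ⟨v, hv, rfl⟩, rfl⟩
    exact ⟨T ∘ v, fun i => Submodule.mem_map_of_mem (hv i), exteriorPower.map_apply_ιMulti _ _⟩
  · rintro ⟨v, hv, rfl⟩
    choose u hu huv using fun i => Submodule.mem_map.mp (hv i)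
    refine ⟨_, ⟨u, hu, rfl⟩, ?_⟩
    rw [exteriorPower.map_apply_ιMulti]
    congr 1
    exact funext huv

theorem map_mixedSub (T : V →ₗ[ℝ] W) (k : ℕ) (E F : Submodule ℝ V) :
    (mixedSub k E F).map (exteriorPower.map k T) = mixedSub k (E.map T) (F.map T) := by
  rw [mixedSub, mixedSub, Submodule.map_span]
  congr 1
  ext w
  constructor
  · rintro ⟨_, ⟨v, hv, ⟨i, hi⟩, rfl⟩, rfl⟩
    exact ⟨T ∘ v, fun i => (hv i).imp Submodule.mem_map_of_mem Submodule.mem_map_of_mem,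
      ⟨i, Submodule.mem_map_of_mem hi⟩, exteriorPower.map_apply_ιMulti _ _⟩
  · rintro ⟨v, hv, ⟨j, hj⟩, rfl⟩
    -- The preimage at the index `j` must come from `E`, whichever alternative `hv j` offers.
    have key : ∀ i, ∃ u, (u ∈ E ∨ u ∈ F) ∧ (i = j → u ∈ E) ∧ T u = v i := by
      intro i
      by_cases hij : i = j
      · subst hij
        obtain ⟨u, hu, huv⟩ := hj
        exact ⟨u, Or.inl hu, fun _ => hu, huv⟩
      · rcases hv i with ⟨u, hu, huv⟩ | ⟨u, hu, huv⟩
        · exact ⟨u, Or.inl hu, fun h => absurd h hij, huv⟩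
        · exact ⟨u, Or.inr hu, fun h => absurd h hij, huv⟩
    choose u hu huj huv using key
    refine ⟨_, ⟨u, hu, ⟨j, huj j rfl⟩, rfl⟩, ?_⟩
    rw [exteriorPower.map_apply_ιMulti]
    congr 1
    exact funext huv

section AdaptedBasis

variable {ι : Type*} [LinearOrder ι] (b : Module.Basis ι ℝ V) {p : ι → Prop} {k : ℕ}

/-- The coordinates of v₁ ∧ ⋯ ∧ v_k are minors of the coordinate matrix of the v_i. Here an index of
`s` satisfying `p` gives a zero column; in `mixedSub_span_basis` a factor from the first subspace
gives a zero row when `s` avoids `p`. -/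
theorem wedgeSub_span_basis :
    wedgeSub k (Submodule.span ℝ (b '' {i | ¬ p i})) =
      Submodule.span ℝ (exteriorPower.ιMulti_family ℝ k b ''
        {s | ∀ i ∈ s, ¬ p i}) := by
  apply le_antisymm
  · rw [wedgeSub, Submodule.span_le]
    rintro _ ⟨v, hv, rfl⟩
    rw [← exteriorPower.coe_basis, SetLike.mem_coe, Module.Basis.mem_span_image]
    intro s hs i his hpi
    rw [Finset.mem_coe, Finsupp.mem_support_iff, exteriorPower.basis_repr_apply,
      exteriorPower.ιMultiDual_apply_ιMulti] at hs
    obtain ⟨j, rfl⟩ := (Set.powersetCard.mem_range_ofFinEmbEquiv_symm_iff_mem s i).mpr his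
    refine hs (Matrix.det_eq_zero_of_column_eq_zero j fun l => ?_)
    by_contra h
    exact (b.mem_span_image.mp (hv l)) (Finsupp.mem_support_iff.mpr h) hpi
  · rw [Submodule.span_le]
    rintro _ ⟨s, hs, rfl⟩
    refine Submodule.subset_span ⟨_, fun i => Submodule.subset_span ?_, rfl⟩
    exact ⟨_, hs _ ((Set.powersetCard.mem_range_ofFinEmbEquiv_symm_iff_mem s _).mp ⟨i, rfl⟩), rfl⟩

theorem mixedSub_span_basis :
    mixedSub k (Submodule.span ℝ (b '' {i | p i})) (Submodule.span ℝ (b '' {i | ¬ p i})) =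
      Submodule.span ℝ (exteriorPower.ιMulti_family ℝ k b ''
        {s | ∃ i ∈ s, p i}) := by
  apply le_antisymm
  · rw [mixedSub, Submodule.span_le]
    rintro _ ⟨v, hv, ⟨l, hl⟩, rfl⟩
    rw [← exteriorPower.coe_basis, SetLike.mem_coe, Module.Basis.mem_span_image]
    intro s hs
    by_contra hsp
    rw [Finset.mem_coe, Finsupp.mem_support_iff, exteriorPower.basis_repr_apply,
      exteriorPower.ιMultiDual_apply_ιMulti] at hs
    refine hs (Matrix.det_eq_zero_of_row_eq_zero l fun j => ?_)
    by_contra h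
    exact hsp ⟨_, (Set.powersetCard.mem_range_ofFinEmbEquiv_symm_iff_mem s _).mp ⟨j, rfl⟩,
      (b.mem_span_image.mp hl) (Finsupp.mem_support_iff.mpr h)⟩
  · rw [Submodule.span_le]
    rintro _ ⟨s, ⟨i, his, hi⟩, rfl⟩
    obtain ⟨j, rfl⟩ := (Set.powersetCard.mem_range_ofFinEmbEquiv_symm_iff_mem s i).mpr his
    refine Submodule.subset_span ⟨_, fun i => ?_, ⟨j, Submodule.subset_span ⟨_, hi, rfl⟩⟩, rfl⟩
    by_cases h : p (Set.powersetCard.ofFinEmbEquiv.symm s i)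
    · exact Or.inl (Submodule.subset_span ⟨_, h, rfl⟩)
    · exact Or.inr (Submodule.subset_span ⟨_, h, rfl⟩)

end AdaptedBasis

/-- Bases of two complementary subspaces combine into a basis. -/
theorem exists_basis_append {E F : Submodule ℝ V} (h : IsCompl E F) {m d : ℕ}
    {e : Fin m → V} {f : Fin d → V} (he : LinearIndependent ℝ e) (hf : LinearIndependent ℝ f)
    (heE : Submodule.span ℝ (range e) = E) (hfF : Submodule.span ℝ (range f) = F) :
    ∃ b : Module.Basis (Fin (m + d)) ℝ V, ⇑b = Fin.append e f ∧
      E = Submodule.span ℝ (b '' {i | i.val < m}) ∧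
      F = Submodule.span ℝ (b '' {i | ¬ i.val < m}) := by
  have hli : LinearIndependent ℝ (Sum.elim e f) :=
    he.sum_type hf (by rw [heE, hfF]; exact h.disjoint)
  have hsp : ⊤ ≤ Submodule.span ℝ (range (Sum.elim e f)) := by
    rw [Set.Sum.elim_range, Submodule.span_union, heE, hfF, h.sup_eq_top]
  refine ⟨(Module.Basis.mk hli hsp).reindex finSumFinEquiv, ?_, ?_, ?_⟩
  · ext i
    refine Fin.addCases (fun i => ?_) (fun i => ?_) i <;> simp
  · rw [← heE]
    congr 1
    ext v
    constructor
    · rintro ⟨i, rfl⟩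
      exact ⟨Fin.castAdd d i, by simp, by simp⟩
    · rintro ⟨i, hi, rfl⟩
      exact ⟨⟨i, hi⟩, by
        obtain ⟨j, rfl⟩ : ∃ j : Fin m, i = Fin.castAdd d j := ⟨⟨i, hi⟩, rfl⟩
        simp⟩
  · rw [← hfF]
    congr 1
    ext v
    constructor
    · rintro ⟨i, rfl⟩
      exact ⟨Fin.natAdd m i, by simp, by simp⟩
    · rintro ⟨i, hi, rfl⟩
      have hi' : ¬ i.val < m := hi
      obtain ⟨j, rfl⟩ : ∃ j : Fin d, i = Fin.natAdd m j :=
        ⟨⟨i - m, by omega⟩, by ext; simp; omega⟩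
      exact ⟨j, by simp⟩

end Algebra

section LinearAlgebra

variable {V W : Type*}
  [NormedAddCommGroup V] [InnerProductSpace ℝ V] [FiniteDimensional ℝ V]
  [NormedAddCommGroup W] [InnerProductSpace ℝ W]

/-! ### Norms of restrictions -/

theorem restrictNorm_nonneg (A : V →ₗ[ℝ] W) (S : Submodule ℝ V) : 0 ≤ restrictNorm A S := by
  unfold restrictNorm
  positivity

theorem norm_le_restrictNorm (A : V →ₗ[ℝ] W) {S : Submodule ℝ V} {v : V} (hv : v ∈ S) :
    ‖A v‖ ≤ restrictNorm A S * ‖v‖ :=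
  (LinearMap.toContinuousLinearMap (A ∘ₗ S.subtype)).le_opNorm ⟨v, hv⟩

theorem restrictNorm_le {A : V →ₗ[ℝ] W} {S : Submodule ℝ V} {c : ℝ} (hc : 0 ≤ c)
    (h : ∀ v ∈ S, ‖A v‖ ≤ c * ‖v‖) : restrictNorm A S ≤ c :=
  ContinuousLinearMap.opNorm_le_bound _ hc fun v => h v v.2

/-! ### Norms of exterior products -/

theorem norm_ιMulti_sq {k : ℕ} (v : Fin k → V) :
    ‖exteriorPower.ιMulti ℝ k v‖ ^ 2 = (Matrix.gram ℝ v).det := by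
  rw [← exteriorPower.inner_ιMulti_self, real_inner_self_eq_norm_sq]

/-- Each of the k! terms of the Gram determinant is bounded by Cauchy–Schwarz. The factor √k! is not
sharp (Hadamard's inequality has 1), but any constant independent of x and t serves. -/
theorem norm_ιMulti_le {k : ℕ} (v : Fin k → V) :
    ‖exteriorPower.ιMulti ℝ k v‖ ≤ √(k.factorial : ℝ) * ∏ i, ‖v i‖ := by
  have hsq : ‖exteriorPower.ιMulti ℝ k v‖ ^ 2 ≤ k.factorial * (∏ i, ‖v i‖) ^ 2 := by
    rw [norm_ιMulti_sq, Matrix.det_apply]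
    refine (le_abs_self _).trans ((Finset.abs_sum_le_sum_abs _ _).trans ?_)
    have hterm : ∀ σ ∈ (Finset.univ : Finset (Equiv.Perm (Fin k))),
        |Equiv.Perm.sign σ • ∏ i, Matrix.gram ℝ v (σ i) i| ≤ (∏ i, ‖v i‖) ^ 2 := by
      intro σ _
      have h1 : |Equiv.Perm.sign σ • ∏ i, Matrix.gram ℝ v (σ i) i|
          = |∏ i, Matrix.gram ℝ v (σ i) i| := by
        rcases Int.units_eq_one_or (Equiv.Perm.sign σ) with h | h <;> simp [h]
      rw [h1, Finset.abs_prod]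
      calc ∏ i, |Matrix.gram ℝ v (σ i) i| ≤ ∏ i, (‖v (σ i)‖ * ‖v i‖) :=
            Finset.prod_le_prod (fun _ _ => abs_nonneg _)
              fun i _ => abs_real_inner_le_norm _ _
        _ = (∏ i, ‖v i‖) ^ 2 := by
            rw [Finset.prod_mul_distrib, Equiv.prod_comp σ (fun i => ‖v i‖), sq]
    refine (Finset.sum_le_card_nsmul _ _ _ hterm).trans ?_
    simp [Fintype.card_perm]
  have h0 : 0 ≤ ∏ i, ‖v i‖ := Finset.prod_nonneg fun _ _ => norm_nonneg _
  refine le_of_sq_le_sq ?_ (by positivity)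
  rw [mul_pow, Real.sq_sqrt (by positivity)]
  exact hsq

theorem norm_ιMulti_of_orthogonal {k : ℕ} {v : Fin k → V}
    (hv : ∀ i j, i ≠ j → inner ℝ (v i) (v j) = 0) :
    ‖exteriorPower.ιMulti ℝ k v‖ = ∏ i, ‖v i‖ := by
  have hg : Matrix.gram ℝ v = Matrix.diagonal fun i => ‖v i‖ ^ 2 := by
    ext i j
    by_cases h : i = j
    · subst h; simp
    · simp [h, hv i j h]
  have h0 : 0 ≤ ∏ i, ‖v i‖ := Finset.prod_nonneg fun _ _ => norm_nonneg _
  rw [← sq_eq_sq₀ (norm_nonneg _) h0, norm_ιMulti_sq, hg, Matrix.det_diagonal,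
    Finset.prod_pow]

theorem norm_ιMulti_of_orthonormal {k : ℕ} {v : Fin k → V} (hv : Orthonormal ℝ v) :
    ‖exteriorPower.ιMulti ℝ k v‖ = 1 := by
  rw [norm_ιMulti_of_orthogonal fun i j h => hv.2 h]
  simp [hv.1]

/-- The coordinates of `⋀^k V` in the basis induced by a basis of `V` are bounded in terms of the
coordinates of `V`. -/
theorem abs_ιMultiDual_le {ι : Type*} [LinearOrder ι] (b : Module.Basis ι ℝ V) {c : ℝ}
    (hb : ∀ i v, |b.coord i v| ≤ c * ‖v‖) {k : ℕ} (s : Set.powersetCard ι k)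
    (w : ⋀[ℝ]^k V) :
    |exteriorPower.ιMultiDual ℝ k b s w| ≤
      (Module.finrank ℝ V).choose k * (k.factorial * c ^ k) * ‖w‖ := by
  -- Expand `w` in an orthonormal basis of products of unit vectors: the functional takes on each of
  -- them the value of a k × k determinant with entries at most `c`.
  set o := (stdOrthonormalBasis ℝ V).exteriorPower k with ho
  have hon : ∀ t, ∃ v : Fin k → V, (∀ i, ‖v i‖ = 1) ∧ o t = exteriorPower.ιMulti ℝ k v := by
    intro t
    refine ⟨stdOrthonormalBasis ℝ V ∘ Set.powersetCard.ofFinEmbEquiv.symm t, fun i => by simp, ?_⟩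
    rw [← OrthonormalBasis.coe_toBasis, OrthonormalBasis.toBasis_exteriorPower,
      exteriorPower.basis_apply]
    rfl
  have hterm : ∀ t ∈ Finset.univ, ‖inner ℝ (o t) w • exteriorPower.ιMultiDual ℝ k b s (o t)‖
      ≤ ‖w‖ * (k.factorial * c ^ k) := by
    intro t _
    obtain ⟨v, hv1, hv⟩ := hon t
    rw [norm_smul]
    refine mul_le_mul ?_ ?_ (norm_nonneg _) (norm_nonneg _)
    · refine (norm_inner_le_norm _ _).trans ?_
      simp
    · rw [hv, exteriorPower.ιMultiDual_apply_ιMulti]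
      have := Matrix.det_le (A := Matrix.of fun i j =>
        b.coord (Set.powersetCard.ofFinEmbEquiv.symm s j) (v i))
        (abv := AbsoluteValue.abs) (x := c) (fun i j => by
          simpa [hv1] using hb (Set.powersetCard.ofFinEmbEquiv.symm s j) (v i))
      simpa using this
  rw [← o.sum_repr' w, map_sum]
  simp only [map_smul]
  rw [o.sum_repr' w]
  refine (norm_sum_le_of_le _ hterm).trans ?_
  rw [Finset.sum_const, Finset.card_univ, ← Module.finrank_eq_card_basis o.toBasis,
    exteriorPower.finrank_eq, nsmul_eq_mul]
  exact le_of_eq (by ring)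

/-! ### Singular value decomposition -/

/-- There is an orthonormal basis of `S` whose image under `T` is orthogonal. -/
theorem exists_orthonormalBasis_image_orthogonal [FiniteDimensional ℝ W] (T : V →ₗ[ℝ] W) (S : Submodule ℝ V) {k : ℕ}
    (hS : Module.finrank ℝ S = k) :
    ∃ f : OrthonormalBasis (Fin k) ℝ S,
      ∀ i j, i ≠ j → inner ℝ (T (f i)) (T (f j)) = 0 := by
  set U : S →ₗ[ℝ] W := T ∘ₗ S.subtype
  have hU := (U.isPositive_adjoint_comp_self).isSymmetric
  refine ⟨hU.eigenvectorBasis hS, fun i j hij => ?_⟩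
  change inner ℝ (U (hU.eigenvectorBasis hS i)) (U (hU.eigenvectorBasis hS j)) = 0
  rw [← LinearMap.adjoint_inner_left, ← LinearMap.comp_apply, hU.apply_eigenvectorBasis,
    inner_smul_left, OrthonormalBasis.inner_eq_zero _ hij, mul_zero]

end LinearAlgebra

/-! ### The line ⋀^k F and the exchange estimate for products -/

section Algebra

variable {V : Type*} [AddCommGroup V] [Module ℝ V]

theorem ιMulti_ne_zero {k : ℕ} {v : Fin k → V} (hv : LinearIndependent ℝ v) :
    exteriorPower.ιMulti ℝ k v ≠ 0 := by
  have h := (exteriorPower.ιMulti_family_linearIndependent_field k hv).ne_zero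
    (Set.powersetCard.ofFinEmbEquiv (RelEmbedding.refl _))
  rwa [exteriorPower.ιMulti_family, Equiv.symm_apply_apply] at h

/-- The top exterior power of `F` itself is one-dimensional; the inclusion of `F` carries this into
⋀^k V. -/
theorem wedgeSub_eq_span_singleton {k : ℕ} {F : Submodule ℝ V} (f : Module.Basis (Fin k) ℝ F) :
    wedgeSub k F = Submodule.span ℝ {exteriorPower.ιMulti ℝ k fun i => (f i : V)} := by
  have : Module.Finite ℝ F := Module.Finite.of_basis f
  have hcard : Module.finrank ℝ F = k := by simp [Module.finrank_eq_card_basis f]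
  have h1 : Module.finrank ℝ (⋀[ℝ]^k F) = 1 := by
    rw [exteriorPower.finrank_eq, hcard, Nat.choose_self]
  rw [finrank_eq_one_iff_of_nonzero' _ (ιMulti_ne_zero f.linearIndependent)] at h1
  have hmap : ∀ v : Fin k → F, exteriorPower.ιMulti ℝ k (fun i => (v i : V)) =
      exteriorPower.map k F.subtype (exteriorPower.ιMulti ℝ k v) := by
    intro v
    rw [exteriorPower.map_apply_ιMulti]
    rfl
  apply le_antisymm
  · rw [wedgeSub, Submodule.span_le]
    rintro _ ⟨v, hv, rfl⟩
    obtain ⟨a, ha⟩ := h1 (exteriorPower.ιMulti ℝ k fun i => (⟨v i, hv i⟩ : F))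
    rw [SetLike.mem_coe, Submodule.mem_span_singleton]
    refine ⟨a, ?_⟩
    rw [hmap, ← map_smul, ha, ← hmap]
  · rw [Submodule.span_le, singleton_subset_iff]
    exact Submodule.subset_span ⟨_, fun i => (f i).2, rfl⟩

/-- Intended for τ i = ‖T b_i‖ with `P` marking the vectors of E. As `s` has as many elements as the
complement of `P`, it omits one index outside `P` for each index it has in `P`. Each such exchange
costs αβ ≤ L r, and at least one and at most `k` take place, so (L r)^a ≤ L^k r. -/
theorem prod_le_pow_mul_prod_filter {ι : Type*} [Fintype ι] [DecidableEq ι] {P : ι → Prop}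
    [DecidablePred P] {τ : ι → ℝ} (hτ : ∀ i, 0 ≤ τ i) {α β L r : ℝ} (hα : 0 ≤ α) (hβ : 0 ≤ β)
    (hL : 1 ≤ L) (hr : 0 ≤ r) (hr1 : r ≤ 1) (hLr : α * β ≤ L * r)
    (hP : ∀ i, P i → τ i ≤ α) (hP' : ∀ i, ¬ P i → 1 ≤ τ i * β)
    {k : ℕ} (hk : (Finset.univ.filter fun i => ¬ P i).card = k) {s : Finset ι} (hs : s.card = k)
    (hsP : ∃ i ∈ s, P i) :
    ∏ i ∈ s, τ i ≤ L ^ k * r * ∏ i ∈ Finset.univ.filter (fun i => ¬ P i), τ i := by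
  set Q := Finset.univ.filter fun i => ¬ P i
  set A := s.filter P
  set B := s.filter fun i => ¬ P i
  have hBQ : B ⊆ Q := fun i hi => by
    simp only [B, Q, Finset.mem_filter] at hi ⊢
    exact ⟨Finset.mem_univ _, hi.2⟩
  have hAB : A.card + B.card = k := by
    rw [← hs]
    exact Finset.card_filter_add_card_filter_not P
  have hQB : (Q \ B).card = A.card := by
    rw [Finset.card_sdiff_of_subset hBQ, hk]
    omega
  have hA1 : A.card ≠ 0 := by
    obtain ⟨i, his, hi⟩ := hsP
    exact Finset.card_ne_zero_of_mem (Finset.mem_filter.mpr ⟨his, hi⟩)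
  have h1 : ∏ i ∈ A, τ i ≤ α ^ A.card :=
    (Finset.prod_le_prod (fun i _ => hτ i)
      fun i hi => hP i (Finset.mem_filter.mp hi).2).trans_eq (Finset.prod_const α)
  have h2 : 1 ≤ (∏ i ∈ Q \ B, τ i) * β ^ A.card := by
    rw [← hQB, ← Finset.prod_const, ← Finset.prod_mul_distrib]
    refine Finset.prod_induction _ (fun x => 1 ≤ x) (fun _ _ => one_le_mul_of_one_le_of_one_le)
      le_rfl fun i hi => hP' i ?_
    exact (Finset.mem_filter.mp (Finset.mem_sdiff.mp hi).1).2
  have h3 : (α * β) ^ A.card ≤ L ^ k * r := by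
    calc (α * β) ^ A.card ≤ (L * r) ^ A.card := by gcongr
      _ = L ^ A.card * r ^ A.card := mul_pow _ _ _
      _ ≤ L ^ k * r := by
          gcongr
          · omega
          · exact pow_le_of_le_one hr hr1 hA1
  have hB0 : 0 ≤ ∏ i ∈ B, τ i := Finset.prod_nonneg fun i _ => hτ i
  have hQB0 : 0 ≤ ∏ i ∈ Q \ B, τ i := Finset.prod_nonneg fun i _ => hτ i
  calc ∏ i ∈ s, τ i = (∏ i ∈ A, τ i) * ∏ i ∈ B, τ i :=
        (Finset.prod_filter_mul_prod_filter_not s P τ).symm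
    _ ≤ α ^ A.card * ∏ i ∈ B, τ i := by gcongr
    _ ≤ (α ^ A.card * ∏ i ∈ B, τ i) * ((∏ i ∈ Q \ B, τ i) * β ^ A.card) :=
        le_mul_of_one_le_right (by positivity) h2
    _ = (α * β) ^ A.card * ((∏ i ∈ Q \ B, τ i) * ∏ i ∈ B, τ i) := by rw [mul_pow]; ring
    _ = (α * β) ^ A.card * ∏ i ∈ Q, τ i := by rw [Finset.prod_sdiff hBQ]
    _ ≤ L ^ k * r * ∏ i ∈ Q, τ i := by
        gcongr
        exact Finset.prod_nonneg fun i _ => hτ i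

end Algebra

/-! ### Adapted coordinates and volume distortion -/

section LinearAlgebra

variable {V W Z : Type*}
  [NormedAddCommGroup V] [InnerProductSpace ℝ V]
  [NormedAddCommGroup W] [InnerProductSpace ℝ W]
  [NormedAddCommGroup Z] [InnerProductSpace ℝ Z]

theorem norm_coe_orthonormalBasis {ι : Type*} [Fintype ι] {F : Submodule ℝ V}
    (f : OrthonormalBasis ι ℝ F) (i : ι) : ‖(f i : V)‖ = 1 :=
  f.norm_eq_one i

/-- The coordinates are inner products of unit vectors with the components x ∈ E and y ∈ F of v. The
angle hypothesis gives ‖x‖ ≤ c‖v‖, and y = v - x then gives the constant 1 + c. -/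
theorem abs_coord_append_le {E F : Submodule ℝ V} {c : ℝ}
    (hc : ∀ e ∈ E, ∀ f ∈ F, ‖e‖ ≤ c * ‖e + f‖) {m d : ℕ}
    (e : OrthonormalBasis (Fin m) ℝ E) (f : OrthonormalBasis (Fin d) ℝ F)
    {b : Module.Basis (Fin (m + d)) ℝ V}
    (hb : ⇑b = Fin.append (fun i => (e i : V)) fun i => (f i : V)) (i : Fin (m + d)) (v : V) :
    |b.coord i v| ≤ (1 + c) * ‖v‖ := by
  set x : E := ∑ i, b.repr v (Fin.castAdd d i) • e i with hx
  set y : F := ∑ i, b.repr v (Fin.natAdd m i) • f i with hy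
  have hv : v = x + y := by
    conv_lhs => rw [← b.sum_repr v, Fin.sum_univ_add]
    simp [hx, hy, hb]
  have hxv : ‖x‖ ≤ c * ‖v‖ := by
    have := hc x x.2 y y.2
    rwa [← hv] at this
  have hyv : ‖y‖ ≤ (1 + c) * ‖v‖ := by
    have h : (y : V) = v - x := by rw [hv]; abel
    have h2 : ‖y‖ ≤ ‖v‖ + ‖x‖ := by
      change ‖(y : V)‖ ≤ ‖v‖ + ‖(x : V)‖
      rw [h]
      exact norm_sub_le _ _
    linarith
  rw [Module.Basis.coord_apply]
  refine Fin.addCases (fun i => ?_) (fun i => ?_) i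
  · have h : b.repr v (Fin.castAdd d i) = inner ℝ (e i) x := by
      rw [hx, e.orthonormal.inner_right_fintype]
    rw [h]
    refine (abs_real_inner_le_norm _ _).trans ?_
    rw [e.norm_eq_one, one_mul]
    linarith [norm_nonneg v]
  · have h : b.repr v (Fin.natAdd m i) = inner ℝ (f i) y := by
      rw [hy, f.orthonormal.inner_right_fintype]
    rw [h]
    refine (abs_real_inner_le_norm _ _).trans ?_
    rwa [f.norm_eq_one, one_mul]

variable [FiniteDimensional ℝ V]

theorem restrictNorm_span_singleton (A : V →ₗ[ℝ] W) (w : V) :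
    restrictNorm A (Submodule.span ℝ {w}) * ‖w‖ = ‖A w‖ := by
  refine le_antisymm ?_ (norm_le_restrictNorm A (Submodule.mem_span_singleton_self w))
  rcases eq_or_ne w 0 with rfl | hw
  · simp
  have hw' : 0 < ‖w‖ := norm_pos_iff.mpr hw
  rw [← le_div_iff₀ hw']
  refine restrictNorm_le (by positivity) fun v hv => ?_
  obtain ⟨a, rfl⟩ := Submodule.mem_span_singleton.mp hv
  rw [map_smul, norm_smul, norm_smul]
  apply le_of_eq
  field_simp

variable [FiniteDimensional ℝ W] [FiniteDimensional ℝ Z]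

/-- The Gram determinant of the images is the same for every orthonormal basis, so the singular
basis may replace the standard one. -/
theorem absDetOn_eq_norm_ιMulti (T : V →ₗ[ℝ] W) {F : Submodule ℝ V} {k : ℕ}
    (f : OrthonormalBasis (Fin k) ℝ F) :
    absDetOn T F = ‖exteriorPower.ιMulti ℝ k fun i => T (f i)‖ := by
  have h1 := (T ∘ₗ F.subtype).normDet_sq_eq_det_gram (stdOrthonormalBasis ℝ F)
  have h2 := (T ∘ₗ F.subtype).normDet_sq_eq_det_gram f
  rw [absDetOn, Real.sqrt_eq_iff_mul_self_eq (Matrix.posSemidef_gram ℝ _).det_nonneg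
    (norm_nonneg _), ← sq, norm_ιMulti_sq]
  exact h1.symm.trans h2

theorem absDetOn_eq_one {T : V →ₗ[ℝ] W} {F : Submodule ℝ V} (hT : ∀ v ∈ F, ‖T v‖ = ‖v‖) :
    absDetOn T F = 1 := by
  let L : F →ₗᵢ[ℝ] W := ⟨T ∘ₗ F.subtype, fun v => hT v v.2⟩
  rw [absDetOn_eq_norm_ιMulti T (stdOrthonormalBasis ℝ F)]
  exact norm_ιMulti_of_orthonormal ((stdOrthonormalBasis ℝ F).orthonormal.comp_linearIsometry L)

/-- If `S ∘ T` is isometric on `F`, the norm of `⋀^k S` on the line `⋀^k (T F)` is the inverse of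
the volume distortion of `T` on `F`. -/
theorem restrictNorm_wedgeSub_mul_absDetOn {T : V →ₗ[ℝ] W} {S : W →ₗ[ℝ] Z} {F : Submodule ℝ V}
    {k : ℕ} (hF : Module.finrank ℝ F = k) (hST : ∀ v ∈ F, ‖S (T v)‖ = ‖v‖) :
    restrictNorm (exteriorPower.map k S) (wedgeSub k (F.map T)) * absDetOn T F = 1 := by
  subst hF
  let f := stdOrthonormalBasis ℝ F
  let L : F →ₗᵢ[ℝ] Z := ⟨S ∘ₗ T ∘ₗ F.subtype, fun v => hST v v.2⟩
  rw [← map_wedgeSub, wedgeSub_eq_span_singleton f.toBasis, Submodule.map_span, image_singleton,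
    exteriorPower.map_apply_ιMulti, absDetOn_eq_norm_ιMulti T f]
  have : (T ∘ fun i => ((f.toBasis i : F) : V)) = fun i => T (f i) := by
    ext i; simp
  rw [this, restrictNorm_span_singleton, exteriorPower.map_apply_ιMulti]
  exact norm_ιMulti_of_orthonormal (f.orthonormal.comp_linearIsometry L)

/-! ### Domination and exterior powers -/

theorem restrictNorm_mixedSub_mul_le {T : V →ₗ[ℝ] W} {S : W →ₗ[ℝ] Z} {E F : Submodule ℝ V}
    (hEF : IsCompl E F) {c : ℝ} (hc0 : 0 ≤ c) (hc : ∀ e ∈ E, ∀ f ∈ F, ‖e‖ ≤ c * ‖e + f‖)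
    {k : ℕ} (hF : Module.finrank ℝ F = k) (hST : ∀ v ∈ F, ‖S (T v)‖ = ‖v‖)
    {L r : ℝ} (hL : 1 ≤ L) (hr : 0 ≤ r) (hr1 : r ≤ 1)
    (hLr : restrictNorm T E * restrictNorm S (F.map T) ≤ L * r) :
    restrictNorm (exteriorPower.map k T) (mixedSub k E F) *
        restrictNorm (exteriorPower.map k S) (wedgeSub k (F.map T)) ≤
      (Module.finrank ℝ V).choose k * ((Module.finrank ℝ V).choose k *
        (k.factorial * (1 + c) ^ k)) * √(k.factorial : ℝ) * L ^ k * r := by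
  set N : ℝ := ((Module.finrank ℝ V).choose k : ℝ)
  obtain ⟨f, hf⟩ := exists_orthonormalBasis_image_orthogonal T F hF
  set D : ℝ := ∏ i, ‖T (f i)‖ with hD
  have hD0 : 0 ≤ D := Finset.prod_nonneg fun _ _ => norm_nonneg _
  have hρ : restrictNorm (exteriorPower.map k S) (wedgeSub k (F.map T)) * D = 1 := by
    rw [hD, ← norm_ιMulti_of_orthogonal hf, ← absDetOn_eq_norm_ιMulti]
    exact restrictNorm_wedgeSub_mul_absDetOn hF hST
  have hρ0 := restrictNorm_nonneg (exteriorPower.map k S) (wedgeSub k (F.map T))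
  -- Since the norm of ⋀^k S on the line is 1/D, it suffices to bound ⋀^k T by a multiple of D. In
  -- the constant, one N counts basis vectors, N k! (1+c)^k bounds coordinates, and √k! comes from
  -- `norm_ιMulti_le`.
  suffices h : restrictNorm (exteriorPower.map k T) (mixedSub k E F) ≤
      N * (N * (k.factorial * (1 + c) ^ k)) * √(k.factorial : ℝ) * L ^ k * r * D by
    calc _ ≤ N * (N * (k.factorial * (1 + c) ^ k)) * √(k.factorial : ℝ) * L ^ k * r * D *
          restrictNorm (exteriorPower.map k S) (wedgeSub k (F.map T)) := by gcongr
      _ = N * (N * (k.factorial * (1 + c) ^ k)) * √(k.factorial : ℝ) * L ^ k * r *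
          (restrictNorm (exteriorPower.map k S) (wedgeSub k (F.map T)) * D) := by ring
      _ = _ := by rw [hρ, mul_one]
  refine restrictNorm_le (by positivity) fun w hw => ?_
  let e := stdOrthonormalBasis ℝ E
  have he : Submodule.span ℝ (range fun i => (e i : V)) = E := by
    have := congrArg (Submodule.map E.subtype) e.toBasis.span_eq
    rwa [Submodule.map_span, ← range_comp, Submodule.map_top, Submodule.range_subtype,
      OrthonormalBasis.coe_toBasis] at this
  have hf' : Submodule.span ℝ (range fun i => (f i : V)) = F := by
    have := congrArg (Submodule.map F.subtype) f.toBasis.span_eq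
    rwa [Submodule.map_span, ← range_comp, Submodule.map_top, Submodule.range_subtype,
      OrthonormalBasis.coe_toBasis] at this
  obtain ⟨b, hb, hbE, hbF⟩ := exists_basis_append hEF
    (e.orthonormal.linearIndependent.map' E.subtype E.ker_subtype)
    (f.orthonormal.linearIndependent.map' F.subtype F.ker_subtype) he hf'
  replace hb : ⇑b = Fin.append (fun i => (e i : V)) fun i => (f i : V) := hb
  have hcoord := abs_coord_append_le hc e f hb
  rw [hbE, hbF, mixedSub_span_basis, ← exteriorPower.coe_basis,
    Module.Basis.mem_span_image] at hw
  have hprod : ∀ s : Set.powersetCard (Fin (Module.finrank ℝ E + k)) k,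
      (∃ i ∈ s, i.val < Module.finrank ℝ E) →
      ‖exteriorPower.map k T (exteriorPower.ιMulti_family ℝ k b s)‖ ≤
        √(k.factorial : ℝ) * (L ^ k * r * D) := by
    intro s hs
    rw [exteriorPower.map_apply_ιMulti_family, exteriorPower.ιMulti_family]
    refine (norm_ιMulti_le _).trans ?_
    gcongr
    have h1 : ∏ i, ‖(⇑T ∘ ⇑b ∘ ⇑(Set.powersetCard.ofFinEmbEquiv.symm s)) i‖ =
        ∏ i ∈ (s : Finset _), ‖T (b i)‖ := by
      have himage : (s : Finset (Fin (Module.finrank ℝ E + k))) =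
          Finset.univ.image (Set.powersetCard.ofFinEmbEquiv.symm s) := by
        ext i
        rw [Set.powersetCard.mem_coe_iff]
        simpa using (Set.powersetCard.mem_range_ofFinEmbEquiv_symm_iff_mem s i).symm
      rw [himage, Finset.prod_image fun _ _ _ _ h => RelEmbedding.injective _ h]
      rfl
    have h2 : ∏ i ∈ Finset.univ.filter (fun i : Fin (Module.finrank ℝ E + k) =>
        ¬ i.val < Module.finrank ℝ E), ‖T (b i)‖ = D := by
      rw [Finset.prod_filter, Fin.prod_univ_add]
      simp [hb, hD]
    have h3 : (Finset.univ.filter (fun i : Fin (Module.finrank ℝ E + k) =>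
        ¬ i.val < Module.finrank ℝ E)).card = k := by
      rw [Finset.card_filter, Fin.sum_univ_add]
      simp
    refine h1.trans_le ?_
    rw [← h2]
    refine prod_le_pow_mul_prod_filter (fun _ => norm_nonneg _) (restrictNorm_nonneg _ _)
      (restrictNorm_nonneg _ _) hL hr hr1 hLr ?_ ?_ h3 s.2 hs
    · intro i
      refine Fin.addCases (fun i => ?_) (fun i => ?_) i
      · intro _
        rw [hb, Fin.append_left]
        simpa only [norm_coe_orthonormalBasis, mul_one] using norm_le_restrictNorm T (e i).2
      · simp
    · intro i
      refine Fin.addCases (fun i => ?_) (fun i => ?_) i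
      · simp
      · intro _
        rw [hb, Fin.append_right]
        -- 1 = ‖S (T f_i)‖ ≤ β ‖T f_i‖, with β the norm of `S` on the image of `F`.
        have h4 := norm_le_restrictNorm S (Submodule.mem_map_of_mem (f := T) (f i).2)
        rwa [hST _ (f i).2, mul_comm, norm_coe_orthonormalBasis] at h4
  rw [← (b.exteriorPower k).sum_repr w, map_sum]
  have hterm : ∀ s ∈ Finset.univ, ‖exteriorPower.map k T ((b.exteriorPower k).repr w s •
      (b.exteriorPower k) s)‖ ≤ (N * (k.factorial * (1 + c) ^ k) * ‖w‖) *
        (√(k.factorial : ℝ) * (L ^ k * r * D)) := by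
    intro s _
    by_cases hs : (b.exteriorPower k).repr w s = 0
    · rw [hs, zero_smul, map_zero, norm_zero]
      positivity
    · rw [map_smul, norm_smul, exteriorPower.basis_apply]
      refine mul_le_mul ?_ (hprod s (hw (Finsupp.mem_support_iff.mpr hs))) (norm_nonneg _)
        (by positivity)
      rw [exteriorPower.basis_repr_apply]
      exact abs_ιMultiDual_le b hcoord s w
  rw [(b.exteriorPower k).sum_repr w]
  refine (norm_sum_le_of_le _ hterm).trans ?_
  rw [Finset.sum_const, Finset.card_univ, ← Module.finrank_eq_card_basis (b.exteriorPower k),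
    exteriorPower.finrank_eq, nsmul_eq_mul]
  exact le_of_eq (by ring)

/-- Subtracting from `x` its projection `y` onto the span of the other `g i` leaves the exterior
product unchanged and makes its factors orthogonal, so its norm is a product. As y ∈ F, the angle
bound gives ‖x‖ ≤ c‖x - y‖. -/
theorem norm_mul_prod_erase_le {E F : Submodule ℝ V} {c : ℝ}
    (hc : ∀ e ∈ E, ∀ f ∈ F, ‖e‖ ≤ c * ‖e + f‖) {k : ℕ} {g : Fin k → V} (hgF : ∀ i, g i ∈ F)
    (hg : ∀ i j, i ≠ j → inner ℝ (g i) (g j) = 0) (i₀ : Fin k) {x : V} (hx : x ∈ E) :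
    ‖x‖ * ∏ i ∈ Finset.univ.erase i₀, ‖g i‖ ≤
      c * ‖exteriorPower.ιMulti ℝ k (Function.update g i₀ x)‖ := by
  -- A vanishing `g i` is harmless: its coefficient is 0 by the convention on division.
  set y : V := ∑ i ∈ Finset.univ.erase i₀, (inner ℝ (g i) x / ‖g i‖ ^ 2) • g i with hy
  have hyF : y ∈ F := Submodule.sum_mem _ fun i _ => F.smul_mem _ (hgF i)
  have horth : ∀ j, j ≠ i₀ → inner ℝ (g j) (x - y) = 0 := by
    intro j hj
    rw [inner_sub_right, hy, inner_sum, Finset.sum_eq_single j]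
    · rw [inner_smul_right, real_inner_self_eq_norm_sq]
      rcases eq_or_ne (g j) 0 with h | h
      · simp [h]
      · have : ‖g j‖ ≠ 0 := norm_ne_zero_iff.mpr h
        field_simp
        ring
    · intro i _ hij
      rw [inner_smul_right, hg j i hij.symm, mul_zero]
    · intro h
      simp [hj] at h
  have heq : exteriorPower.ιMulti ℝ k (Function.update g i₀ x) =
      exteriorPower.ιMulti ℝ k (Function.update g i₀ (x - y)) := by
    rw [AlternatingMap.map_update_sub, hy, AlternatingMap.map_update_sum,
      Finset.sum_eq_zero, sub_zero]
    intro i hi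
    rw [AlternatingMap.map_update_smul,
      AlternatingMap.map_update_self _ _ (Finset.ne_of_mem_erase hi).symm, smul_zero]
  have hnorm : ‖exteriorPower.ιMulti ℝ k (Function.update g i₀ (x - y))‖ =
      ‖x - y‖ * ∏ i ∈ Finset.univ.erase i₀, ‖g i‖ := by
    rw [norm_ιMulti_of_orthogonal, ← Finset.mul_prod_erase _ _ (Finset.mem_univ i₀),
      Function.update_self]
    · congr 1
      refine Finset.prod_congr rfl fun i hi => ?_
      rw [Function.update_of_ne (Finset.ne_of_mem_erase hi)]
    · intro i j hij
      rcases eq_or_ne i i₀ with rfl | hi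
      · rw [Function.update_self, Function.update_of_ne hij.symm, real_inner_comm]
        exact horth j hij.symm
      · rw [Function.update_of_ne hi]
        rcases eq_or_ne j i₀ with rfl | hj
        · rw [Function.update_self]
          exact horth i hi
        · rw [Function.update_of_ne hj]
          exact hg i j hij
  rw [heq, hnorm, ← mul_assoc]
  gcongr
  have := hc x hx (-y) (F.neg_mem hyF)
  rwa [← sub_eq_add_neg] at this

theorem restrictNorm_mul_le_mixedSub {T : V →ₗ[ℝ] W} {S : W →ₗ[ℝ] Z} {E F : Submodule ℝ V}
    {c : ℝ} (hc0 : 0 ≤ c) (hc : ∀ e ∈ E.map T, ∀ f ∈ F.map T, ‖e‖ ≤ c * ‖e + f‖)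
    {k : ℕ} (hk : 1 ≤ k) (hF : Module.finrank ℝ F = k) (hST : ∀ v ∈ F, ‖S (T v)‖ = ‖v‖) :
    restrictNorm T E * restrictNorm S (F.map T) ≤
      k * c * √(k.factorial : ℝ) * (restrictNorm (exteriorPower.map k T) (mixedSub k E F) *
        restrictNorm (exteriorPower.map k S) (wedgeSub k (F.map T))) := by
  obtain ⟨f, hf⟩ := exists_orthonormalBasis_image_orthogonal T F hF
  set A := restrictNorm (exteriorPower.map k T) (mixedSub k E F)
  set ρ := restrictNorm (exteriorPower.map k S) (wedgeSub k (F.map T))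
  have hA0 : 0 ≤ A := restrictNorm_nonneg _ _
  have hρ0 : 0 ≤ ρ := restrictNorm_nonneg _ _
  have hρ : ρ * ∏ i, ‖T (f i)‖ = 1 := by
    rw [← norm_ιMulti_of_orthogonal hf, ← absDetOn_eq_norm_ιMulti]
    exact restrictNorm_wedgeSub_mul_absDetOn hF hST
  have hpos : ∀ i, 0 < ‖T (f i)‖ := by
    intro i
    rw [norm_pos_iff]
    intro h
    have := hST _ (f i).2
    rw [h, map_zero, norm_zero, norm_coe_orthonormalBasis] at this
    exact zero_ne_one this
  have : Nonempty (Fin k) := ⟨⟨0, hk⟩⟩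
  obtain ⟨i₀, hi₀⟩ := Finite.exists_min fun i => ‖T (f i)‖
  set σ := ‖T (f i₀)‖
  have hσ : 0 < σ := hpos i₀
  -- The sharp bound is 1/σ; summing `k` coordinates, each at most ‖T v‖/σ, loses a factor `k`.
  have hS : restrictNorm S (F.map T) ≤ k / σ := by
    refine restrictNorm_le (by positivity) ?_
    rintro _ ⟨v, hv, rfl⟩
    rw [hST v hv]
    have hrepr : ∀ i, |f.repr ⟨v, hv⟩ i| ≤ ‖T v‖ / σ := by
      intro i
      have hTv : T v = ∑ j, f.repr ⟨v, hv⟩ j • T (f j) := by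
        have := congrArg (T ∘ₗ F.subtype) (f.sum_repr ⟨v, hv⟩)
        rw [map_sum] at this
        simpa using this.symm
      have hin : inner ℝ (T (f i)) (T v) = f.repr ⟨v, hv⟩ i * ‖T (f i)‖ ^ 2 := by
        rw [hTv, inner_sum, Finset.sum_eq_single i]
        · rw [inner_smul_right, real_inner_self_eq_norm_sq]
        · intro j _ hj
          rw [inner_smul_right, hf i j hj.symm, mul_zero]
        · simp
      have hle := abs_real_inner_le_norm (T (f i)) (T v)
      rw [hin, abs_mul, abs_of_nonneg (sq_nonneg ‖T (f i)‖), sq] at hle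
      have hle' : |f.repr ⟨v, hv⟩ i| * ‖T (f i)‖ ≤ ‖T v‖ := by
        refine le_of_mul_le_mul_right ?_ (hpos i)
        linarith
      rw [le_div_iff₀ hσ]
      exact (mul_le_mul_of_nonneg_left (hi₀ i) (abs_nonneg _)).trans hle'
    have hvsum : v = ∑ i, f.repr ⟨v, hv⟩ i • (f i : V) := by
      have := congrArg F.subtype (f.sum_repr ⟨v, hv⟩)
      rw [map_sum] at this
      simpa using this.symm
    calc ‖v‖ = ‖∑ i, f.repr ⟨v, hv⟩ i • (f i : V)‖ := by rw [← hvsum]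
      _ ≤ ∑ _i : Fin k, ‖T v‖ / σ := by
          refine norm_sum_le_of_le _ fun i _ => ?_
          rw [norm_smul, norm_coe_orthonormalBasis, mul_one]
          exact hrepr i
      _ = k / σ * ‖T v‖ := by simp; ring
  -- Test ⋀^k T on the mixed vector obtained by putting `e` in place of f_{i₀}. The remaining
  -- product of the ‖T f_i‖ is 1/(ρσ), and this σ cancels the one in `hS`.
  have hT : restrictNorm T E ≤ c * √(k.factorial : ℝ) * A * ρ * σ := by
    refine restrictNorm_le (by positivity) fun e he => ?_
    have h1 := norm_mul_prod_erase_le hc (g := fun i => T (f i))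
      (fun i => Submodule.mem_map_of_mem (f i).2) hf i₀ (Submodule.mem_map_of_mem he)
    have hmem : exteriorPower.ιMulti ℝ k (Function.update (fun i => (f i : V)) i₀ e) ∈
        mixedSub k E F := by
      refine Submodule.subset_span ⟨_, fun i => ?_, ⟨i₀, ?_⟩, rfl⟩
      · rcases eq_or_ne i i₀ with rfl | h
        · rw [Function.update_self]; exact Or.inl he
        · rw [Function.update_of_ne h]; exact Or.inr (f i).2
      · rw [Function.update_self]; exact he
    have h2 := norm_le_restrictNorm (exteriorPower.map k T) hmem
    rw [exteriorPower.map_apply_ιMulti, Function.comp_update] at h2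
    have h3 : ‖exteriorPower.ιMulti ℝ k (Function.update (fun i => (f i : V)) i₀ e)‖ ≤
        √(k.factorial : ℝ) * ‖e‖ := by
      refine (norm_ιMulti_le _).trans_eq ?_
      rw [← Finset.mul_prod_erase _ _ (Finset.mem_univ i₀), Function.update_self,
        Finset.prod_eq_one, mul_one]
      intro i hi
      rw [Function.update_of_ne (Finset.ne_of_mem_erase hi), norm_coe_orthonormalBasis]
    have h4 : ‖T e‖ * ∏ i ∈ Finset.univ.erase i₀, ‖T (f i)‖ ≤
        c * (A * (√(k.factorial : ℝ) * ‖e‖)) :=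
      h1.trans (mul_le_mul_of_nonneg_left (h2.trans (mul_le_mul_of_nonneg_left h3 hA0)) hc0)
    calc ‖T e‖ = ‖T e‖ * (ρ * (σ * ∏ i ∈ Finset.univ.erase i₀, ‖T (f i)‖)) := by
          rw [Finset.mul_prod_erase _ (fun i => ‖T (f i)‖) (Finset.mem_univ i₀), hρ, mul_one]
      _ = ρ * σ * (‖T e‖ * ∏ i ∈ Finset.univ.erase i₀, ‖T (f i)‖) := by ring
      _ ≤ ρ * σ * (c * (A * (√(k.factorial : ℝ) * ‖e‖))) := by gcongr
      _ = _ := by ring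
  calc restrictNorm T E * restrictNorm S (F.map T)
      ≤ (c * √(k.factorial : ℝ) * A * ρ * σ) * (k / σ) :=
        mul_le_mul hT hS (restrictNorm_nonneg _ _) (by positivity)
    _ = _ := by field_simp

end LinearAlgebra

theorem continuous_comp_ιMulti {V : Type*} [NormedAddCommGroup V] [NormedSpace ℝ V]
    [FiniteDimensional ℝ V] {k : ℕ} (ℓ : ⋀[ℝ]^k V →ₗ[ℝ] ℝ) :
    Continuous fun v : Fin k → V => ℓ (exteriorPower.ιMulti ℝ k v) := by
  let b := Module.finBasis ℝ V
  -- In coordinates the map is a linear combination of minors, hence polynomial.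
  have h : (fun v : Fin k → V => ℓ (exteriorPower.ιMulti ℝ k v)) = fun v =>
      ∑ s, (Matrix.of fun i j => b.coord (Set.powersetCard.ofFinEmbEquiv.symm s j) (v i)).det *
        ℓ (b.exteriorPower k s) := by
    ext v
    conv_lhs => rw [← (b.exteriorPower k).sum_repr (exteriorPower.ιMulti ℝ k v)]
    simp [exteriorPower.basis_repr_apply]
  rw [h]
  refine continuous_finsetSum _ fun s _ => Continuous.mul ?_ continuous_const
  refine Continuous.matrix_det (continuous_matrix fun i j => ?_)
  have hi : Continuous fun v : Fin k → V => v i := continuous_apply i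
  exact (LinearMap.continuous_of_finiteDimensional (b.coord _)).comp hi

/-! ### Continuity of the exterior subbundles and the angle between the summands -/

section Bundle

variable {V : Type*} [NormedAddCommGroup V] [NormedSpace ℝ V]
  {H : Type*} [TopologicalSpace H] {I : ModelWithCorners ℝ V H}
  {M : Type*} [TopologicalSpace M] [ChartedSpace H M] [IsManifold I 1 M]

theorem IsContVectorField.continuousWithinAt_linearMapAt {W : Set M}
    {s : ∀ x : M, TangentSpace I x} (hs : IsContVectorField I W s) {x₀ : M} (hx₀ : x₀ ∈ W) :
    ContinuousWithinAt (fun x =>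
      (trivializationAt V (fun y : M => TangentSpace I y) x₀).linearMapAt ℝ x (s x)) W x₀ := by
  have h := ((FiberBundle.continuousWithinAt_totalSpace V _).mp (hs x₀ hx₀)).2
  have hmem := mem_nhdsWithin_of_mem_nhds (t := W)
    ((trivializationAt V (fun y : M => TangentSpace I y) x₀).open_baseSet.mem_nhds
      (FiberBundle.mem_baseSet_trivializationAt' x₀))
  refine h.congr_of_eventuallyEq ?_ ?_
  · filter_upwards [hmem] with x hx
    rw [Trivialization.coe_linearMapAt_of_mem _ hx]
  · rw [Trivialization.coe_linearMapAt_of_mem _ (FiberBundle.mem_baseSet_trivializationAt' x₀)]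

theorem IsContVectorField.ιMulti [FiniteDimensional ℝ V] {k : ℕ} {W : Set M}
    {v : Fin k → ∀ x : M, TangentSpace I x} (hv : ∀ i, IsContVectorField I W (v i)) :
    IsContMultivectorField I k W fun x => exteriorPower.ιMulti ℝ k fun i => v i x := by
  intro x₀ hx₀ ℓ
  simp only [exteriorPower.map_apply_ιMulti]
  exact (continuous_comp_ιMulti ℓ).continuousAt.comp_continuousWithinAt
    (continuousWithinAt_pi.mpr fun i => (hv i).continuousWithinAt_linearMapAt hx₀)

theorem IsContVectorField.mono {W W' : Set M} {s : ∀ x : M, TangentSpace I x}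
    (hs : IsContVectorField I W s) (h : W' ⊆ W) : IsContVectorField I W' s :=
  ContinuousOn.mono hs h

/-- A family of subspaces of `⋀^k TM` that is locally spanned by a fixed set of exterior products
of the vectors of a continuous frame is a continuous subbundle. -/
theorem isContSubbundle_of_frame [FiniteDimensional ℝ V] {k : ℕ} {Γ : Set M}
    {S : ∀ x : M, Submodule ℝ (⋀[ℝ]^k (TangentSpace I x))}
    (h : ∀ x₀ ∈ Γ, ∃ U ∈ 𝓝 x₀, ∃ (n : ℕ) (v : Fin n → ∀ x : M, TangentSpace I x)
      (A : Set (Set.powersetCard (Fin n) k)), (∀ i, IsContVectorField I (U ∩ Γ) (v i)) ∧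
      ∀ x ∈ U ∩ Γ, LinearIndependent ℝ (fun i => v i x) ∧
        Submodule.span ℝ (exteriorPower.ιMulti_family ℝ k (fun i => v i x) '' A) = S x) :
    IsContSubbundle (IsContMultivectorField I k) Γ S := by
  classical
  intro x₀ hx₀
  obtain ⟨U, hU, n, v, A, hv, hA⟩ := h x₀ hx₀
  let q := (Fintype.equivFin A).symm
  refine ⟨U, hU, Fintype.card A,
    fun j x => exteriorPower.ιMulti_family ℝ k (fun i => v i x) (q j), ?_, ?_⟩
  · intro j
    exact IsContVectorField.ιMulti
      (v := fun i => v (Set.powersetCard.ofFinEmbEquiv.symm (q j : Set.powersetCard (Fin n) k) i))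
      fun i => hv _
  · intro x hx
    obtain ⟨hli, hsp⟩ := hA x hx
    refine ⟨(exteriorPower.ιMulti_family_linearIndependent_field k hli).comp
      (fun j => (q j : Set.powersetCard (Fin n) k))
      (Subtype.val_injective.comp q.injective), ?_⟩
    rw [← hsp]
    congr 1
    ext w
    constructor
    · rintro ⟨j, rfl⟩
      exact ⟨_, (q j).2, rfl⟩
    · rintro ⟨s, hs, rfl⟩
      exact ⟨q.symm ⟨s, hs⟩, by simp⟩

/-- Around each point of `Γ` a continuous splitting has a continuous adapted frame. -/
theorem exists_adapted_frame {Γ : Set M} {E F : ∀ x : M, Submodule ℝ (TangentSpace I x)}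
    (hE : IsContSubbundle (IsContVectorField I) Γ E)
    (hF : IsContSubbundle (IsContVectorField I) Γ F) (hEF : ∀ x ∈ Γ, IsCompl (E x) (F x))
    {x₀ : M} (hx₀ : x₀ ∈ Γ) :
    ∃ U ∈ 𝓝 x₀, ∃ (m n : ℕ) (v : Fin n → ∀ x : M, TangentSpace I x),
      (∀ i, IsContVectorField I (U ∩ Γ) (v i)) ∧
      ∀ x ∈ U ∩ Γ, ∃ b : Module.Basis (Fin n) ℝ (TangentSpace I x), (⇑b = fun i => v i x) ∧
        E x = Submodule.span ℝ (b '' {i | i.val < m}) ∧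
        F x = Submodule.span ℝ (b '' {i | ¬ i.val < m}) := by
  obtain ⟨U₁, hU₁, m, e, he, heE⟩ := hE x₀ hx₀
  obtain ⟨U₂, hU₂, d, f, hf, hfF⟩ := hF x₀ hx₀
  refine ⟨U₁ ∩ U₂, Filter.inter_mem hU₁ hU₂, m, m + d, Fin.append e f, ?_, ?_⟩
  · intro i
    refine Fin.addCases (fun i => ?_) (fun i => ?_) i
    · rw [Fin.append_left]
      exact (he i).mono fun x hx => ⟨hx.1.1, hx.2⟩
    · rw [Fin.append_right]
      exact (hf i).mono fun x hx => ⟨hx.1.2, hx.2⟩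
  · rintro x ⟨⟨hx₁, hx₂⟩, hx⟩
    obtain ⟨b, hb, h⟩ := exists_basis_append (hEF x hx) (heE x ⟨hx₁, hx⟩).1 (hfF x ⟨hx₂, hx⟩).1
      (heE x ⟨hx₁, hx⟩).2 (hfF x ⟨hx₂, hx⟩).2
    refine ⟨b, ?_, h⟩
    rw [hb]
    ext i
    refine Fin.addCases (fun i => ?_) (fun i => ?_) i <;> simp

/-- `E` serves only to complete a frame of `F` to a full frame, to which `wedgeSub_span_basis`
applies. -/
theorem isContSubbundle_wedgeSub [FiniteDimensional ℝ V] {Γ : Set M}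
    {E F : ∀ x : M, Submodule ℝ (TangentSpace I x)}
    (hE : IsContSubbundle (IsContVectorField I) Γ E)
    (hF : IsContSubbundle (IsContVectorField I) Γ F) (hEF : ∀ x ∈ Γ, IsCompl (E x) (F x))
    (k : ℕ) : IsContSubbundle (IsContMultivectorField I k) Γ fun x => wedgeSub k (F x) := by
  refine isContSubbundle_of_frame fun x₀ hx₀ => ?_
  obtain ⟨U, hU, m, n, v, hv, h⟩ := exists_adapted_frame hE hF hEF hx₀
  refine ⟨U, hU, n, v, {s | ∀ i ∈ s, ¬ i.val < m}, hv, fun x hx => ?_⟩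
  obtain ⟨b, hb, -, hbF⟩ := h x hx
  rw [← hb, hbF]
  exact ⟨b.linearIndependent, (wedgeSub_span_basis b).symm⟩

theorem isContSubbundle_mixedSub [FiniteDimensional ℝ V] {Γ : Set M}
    {E F : ∀ x : M, Submodule ℝ (TangentSpace I x)}
    (hE : IsContSubbundle (IsContVectorField I) Γ E)
    (hF : IsContSubbundle (IsContVectorField I) Γ F) (hEF : ∀ x ∈ Γ, IsCompl (E x) (F x))
    (k : ℕ) :
    IsContSubbundle (IsContMultivectorField I k) Γ fun x => mixedSub k (E x) (F x) := by
  refine isContSubbundle_of_frame fun x₀ hx₀ => ?_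
  obtain ⟨U, hU, m, n, v, hv, h⟩ := exists_adapted_frame hE hF hEF hx₀
  refine ⟨U, hU, n, v, {s | ∃ i ∈ s, i.val < m}, hv, fun x hx => ?_⟩
  obtain ⟨b, hb, hbE, hbF⟩ := h x hx
  rw [← hb, hbE, hbF]
  exact ⟨b.linearIndependent, (mixedSub_span_basis b).symm⟩

/-- Near a point where they are linearly independent, continuous families of vectors stay
uniformly linearly independent. -/
theorem exists_norm_le_norm_sum {X : Type*} [TopologicalSpace X] {W : Set X} {x₀ : X} {n : ℕ}
    {u : Fin n → X → V} (hu : ∀ i, ContinuousWithinAt (u i) W x₀)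
    (hli : LinearIndependent ℝ fun i => u i x₀) :
    ∃ C > 0, ∀ᶠ x in 𝓝[W] x₀, ∀ a : Fin n → ℝ, ‖a‖ ≤ C * ‖∑ i, a i • u i x‖ := by
  let L := Fintype.linearCombination ℝ (fun i => u i x₀)
  obtain ⟨K, hK, hanti⟩ := L.exists_antilipschitzWith
    (LinearMap.ker_eq_bot.mpr hli.fintypeLinearCombination_injective)
  have hK' : (0 : ℝ) < K := hK
  refine ⟨2 * K, by positivity, ?_⟩
  have hδ : Filter.Tendsto (fun x => ∑ i, ‖u i x - u i x₀‖) (𝓝[W] x₀) (𝓝 0) := by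
    have : Filter.Tendsto (fun x => ∑ i, ‖u i x - u i x₀‖) (𝓝[W] x₀)
        (𝓝 (∑ i : Fin n, ‖u i x₀ - u i x₀‖)) :=
      tendsto_finsetSum _ fun i _ => ((hu i).sub continuousWithinAt_const).norm
    simpa using this
  -- A displacement below 1/(2K) uses up at most half of the lower bound at `x₀`; hence the constant
  -- 2K.
  have hev := hδ.eventually (gt_mem_nhds (show (0 : ℝ) < 1 / (2 * K) by positivity))
  filter_upwards [hev] with x hx a
  have h1 : ‖a‖ ≤ K * ‖∑ i, a i • u i x₀‖ := by
    have := hanti.le_mul_norm (map_zero L) a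
    simpa [L, Fintype.linearCombination_apply] using this
  have h2 : ‖∑ i, a i • u i x₀‖ ≤ ‖∑ i, a i • u i x‖ + ‖a‖ * (1 / (2 * K)) := by
    have h3 : ∑ i, a i • u i x₀ = ∑ i, a i • u i x - ∑ i, a i • (u i x - u i x₀) := by
      rw [← Finset.sum_sub_distrib]
      refine Finset.sum_congr rfl fun i _ => ?_
      rw [← smul_sub]
      congr 1
      abel
    have h4 : ‖∑ i, a i • (u i x - u i x₀)‖ ≤ ‖a‖ * (1 / (2 * K)) := by
      calc ‖∑ i, a i • (u i x - u i x₀)‖ ≤ ∑ i, ‖a‖ * ‖u i x - u i x₀‖ := by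
            refine norm_sum_le_of_le _ fun i _ => ?_
            rw [norm_smul]
            gcongr
            exact norm_le_pi_norm a i
        _ = ‖a‖ * ∑ i, ‖u i x - u i x₀‖ := by rw [Finset.mul_sum]
        _ ≤ _ := by gcongr
    rw [h3]
    exact (norm_sub_le _ _).trans (by gcongr)
  have h5 : ‖a‖ ≤ K * ‖∑ i, a i • u i x‖ + ‖a‖ / 2 := by
    calc ‖a‖ ≤ K * (‖∑ i, a i • u i x‖ + ‖a‖ * (1 / (2 * K))) := h1.trans (by gcongr)
      _ = _ := by field_simp
  linarith

/-- The angle between the summands of a continuous splitting over a compact set is bounded from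
below. -/
theorem exists_angle_bound [FiniteDimensional ℝ V]
    [RiemannianBundle (fun x : M => TangentSpace I x)]
    [IsContinuousRiemannianBundle V (fun x : M => TangentSpace I x)]
    {Γ : Set M} (hΓ : IsCompact Γ) {E F : ∀ x : M, Submodule ℝ (TangentSpace I x)}
    (hE : IsContSubbundle (IsContVectorField I) Γ E)
    (hF : IsContSubbundle (IsContVectorField I) Γ F) (hEF : ∀ x ∈ Γ, IsCompl (E x) (F x)) :
    ∃ C > 0, ∀ x ∈ Γ, ∀ e ∈ E x, ∀ f ∈ F x, ‖e‖ ≤ C * ‖e + f‖ := by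
  -- A bound passes to subsets and to finite unions, so one near each point of Γ is enough.
  refine hΓ.induction_on (p := fun s => ∃ C > 0, ∀ x ∈ s, ∀ e ∈ E x, ∀ f ∈ F x,
    ‖e‖ ≤ C * ‖e + f‖) ⟨1, one_pos, by simp⟩ ?_ ?_ ?_
  · rintro s t hst ⟨C, hC, h⟩
    exact ⟨C, hC, fun x hx => h x (hst hx)⟩
  · rintro s t ⟨C, hC, h⟩ ⟨C', hC', h'⟩
    refine ⟨max C C', lt_max_of_lt_left hC, fun x hx e he f hf => ?_⟩
    rcases hx with hx | hx
    · exact (h x hx e he f hf).trans (by gcongr; exact le_max_left _ _)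
    · exact (h' x hx e he f hf).trans (by gcongr; exact le_max_right _ _)
  intro x₀ hx₀
  obtain ⟨U, hU, m, n, v, hv, h⟩ := exists_adapted_frame hE hF hEF hx₀
  set τ := trivializationAt V (fun y : M => TangentSpace I y) x₀
  have hx₀τ : x₀ ∈ τ.baseSet := FiberBundle.mem_baseSet_trivializationAt' x₀
  have hx₀U : x₀ ∈ U ∩ Γ := ⟨mem_of_mem_nhds hU, hx₀⟩
  have hcont : ∀ i, ContinuousWithinAt (fun x => τ.linearMapAt ℝ x (v i x)) (U ∩ Γ) x₀ :=
    fun i => (hv i).continuousWithinAt_linearMapAt hx₀U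
  have hli : LinearIndependent ℝ fun i => τ.linearMapAt ℝ x₀ (v i x₀) := by
    obtain ⟨b, hb, -⟩ := h x₀ hx₀U
    have := b.linearIndependent.map' (τ.linearMapAt ℝ x₀) (by
      rw [LinearMap.ker_eq_bot]
      exact Function.LeftInverse.injective (τ.symmₗ_linearMapAt (R := ℝ) hx₀τ))
    rwa [hb] at this
  obtain ⟨C, hC, hCev⟩ := exists_norm_le_norm_sum hcont hli
  obtain ⟨C₁, hC₁, hC₁ev⟩ :=
    eventually_norm_trivializationAt_lt V (fun y : M => TangentSpace I y) x₀
  obtain ⟨C₂, hC₂, hC₂ev⟩ :=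
    eventually_norm_symmL_trivializationAt_lt V (fun y : M => TangentSpace I y) x₀
  set R := ∑ i, ‖τ.linearMapAt ℝ x₀ (v i x₀)‖ + 1
  have hR : 0 < R := by positivity
  have hRev : ∀ᶠ x in 𝓝[U ∩ Γ] x₀, ∑ i, ‖τ.linearMapAt ℝ x (v i x)‖ < R := by
    have : Filter.Tendsto (fun x => ∑ i, ‖τ.linearMapAt ℝ x (v i x)‖) (𝓝[U ∩ Γ] x₀)
        (𝓝 (∑ i, ‖τ.linearMapAt ℝ x₀ (v i x₀)‖)) :=
      tendsto_finsetSum _ fun i _ => (hcont i).norm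
    exact this.eventually (gt_mem_nhds (lt_add_one _))
  have hnhds : 𝓝[U ∩ Γ] x₀ = 𝓝[Γ] x₀ := by
    rw [inter_comm]
    exact (nhdsWithin_inter_of_mem' (mem_nhdsWithin_of_mem_nhds hU))
  -- C₁ and C₂ bound the trivialization and its inverse, C bounds the frame coordinates of a vector,
  -- and R the size of the frame. Projecting to `E` merely discards the coordinates of index at
  -- least `m`.
  have hall : ∀ᶠ x in 𝓝[U ∩ Γ] x₀, ∀ e ∈ E x, ∀ f ∈ F x,
      ‖e‖ ≤ (C₂ * (R * (C * C₁))) * ‖e + f‖ := by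
    filter_upwards [hCev, hRev, mem_nhdsWithin_of_mem_nhds hC₁ev, mem_nhdsWithin_of_mem_nhds hC₂ev,
      self_mem_nhdsWithin, mem_nhdsWithin_of_mem_nhds (τ.open_baseSet.mem_nhds hx₀τ)]
      with x hxC hxR hx₁ hx₂ hxU hxτ e he f hf
    obtain ⟨b, hb, hbE, hbF⟩ := h x hxU
    have hbi : ∀ i, b i = v i x := fun i => congrFun hb i
    set a := b.repr (e + f)
    have hsum : e + f = ∑ i, a i • v i x := by
      rw [← b.sum_repr (e + f)]
      simp only [hbi, a]
    have hee : e = ∑ i, (if i.val < m then a i else 0) • v i x := by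
      rw [hbE, Module.Basis.mem_span_image] at he
      rw [hbF, Module.Basis.mem_span_image] at hf
      conv_lhs => rw [← b.sum_repr e]
      refine Finset.sum_congr rfl fun i _ => ?_
      rw [hbi]
      congr 1
      split_ifs with hi
      · have : b.repr f i = 0 := by
          by_contra hne
          exact hf (Finsupp.mem_support_iff.mpr hne) hi
        simp [a, this]
      · by_contra hne
        exact hi (he (Finsupp.mem_support_iff.mpr hne))
    have h1 : ‖τ.linearMapAt ℝ x e‖ ≤ R * ‖(a : Fin n → ℝ)‖ := by
      rw [hee, map_sum]
      calc _ ≤ ∑ i, ‖τ.linearMapAt ℝ x (v i x)‖ * ‖(a : Fin n → ℝ)‖ := by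
            refine norm_sum_le_of_le _ fun i _ => ?_
            rw [map_smul, norm_smul, mul_comm]
            gcongr
            split_ifs
            · exact norm_le_pi_norm (a : Fin n → ℝ) i
            · simp
        _ = (∑ i, ‖τ.linearMapAt ℝ x (v i x)‖) * ‖(a : Fin n → ℝ)‖ := by rw [Finset.sum_mul]
        _ ≤ _ := by gcongr
    have h2 : ‖(a : Fin n → ℝ)‖ ≤ C * ‖τ.linearMapAt ℝ x (e + f)‖ := by
      have := hxC a
      rwa [hsum, map_sum, Finset.sum_congr rfl fun i _ => map_smul _ _ _]
    have h3 : ‖τ.linearMapAt ℝ x (e + f)‖ ≤ C₁ * ‖e + f‖ :=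
      (τ.continuousLinearMapAt ℝ x).le_of_opNorm_le (le_of_lt hx₁) _
    have h4 : ‖e‖ ≤ C₂ * ‖τ.linearMapAt ℝ x e‖ := by
      have := (τ.symmL ℝ x).le_of_opNorm_le (le_of_lt hx₂) (τ.continuousLinearMapAt ℝ x e)
      rwa [τ.symmL_continuousLinearMapAt hxτ] at this
    calc ‖e‖ ≤ C₂ * (R * (C * (C₁ * ‖e + f‖))) := by
          refine h4.trans ?_
          gcongr
          refine h1.trans ?_
          gcongr
          refine h2.trans ?_
          gcongr
      _ = _ := by ring
  rw [hnhds] at hall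
  exact ⟨_, hall, C₂ * (R * (C * C₁)), by positivity, fun x hx => hx⟩

end Bundle

/-! ### The derivative of the flow -/

section Flow

variable {V : Type*} [NormedAddCommGroup V] [NormedSpace ℝ V]
  {H : Type*} [TopologicalSpace H] {I : ModelWithCorners ℝ V H}
  {M : Type*} [TopologicalSpace M] [ChartedSpace H M]

theorem norm_mfderiv_of_eq_id [RiemannianBundle (fun x : M => TangentSpace I x)] {f : M → M}
    (hf : f = id) (x : M) (v : TangentSpace I x) : ‖mfderiv I I f x v‖ = ‖v‖ := by
  subst hf
  rw [mfderiv_id]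
  rfl

/-- A flow is differentiable at the points where its derivative is onto a nonzero subspace. -/
theorem mdifferentiableAt_of_map_ne_bot {φ : ℝ → M → M} {t : ℝ} {x : M}
    {F : Submodule ℝ (TangentSpace I x)} (h : F.map (derivCocycle I φ t x) ≠ ⊥) :
    MDifferentiableAt I I (φ t) x := by
  by_contra hd
  refine h ?_
  -- Without differentiability `mfderiv` takes its default value 0, which sends `F` to `⊥`.
  rw [derivCocycle, mfderiv_zero_of_not_mdifferentiableAt hd]
  exact Submodule.map_zero F

/-- Chain rule for X_{-t} ∘ X_t = id. Comparing norms avoids transport: the composite lands in the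
tangent space at `φ (-t) (φ t x)`, which equals `x` only propositionally. -/
theorem norm_derivCocycle_neg [IsManifold I 1 M]
    [RiemannianBundle (fun x : M => TangentSpace I x)]
    {X : ∀ x : M, TangentSpace I x} {φ : ℝ → M → M} (hφ : IsFlowOf I X φ) {t : ℝ} (ht : 0 ≤ t)
    {x : M} (h₁ : MDifferentiableAt I I (φ t) x) (h₂ : MDifferentiableAt I I (φ (-t)) (φ t x))
    (v : TangentSpace I x) :
    ‖derivCocycle I φ (-t) (φ t x) (derivCocycle I φ t x v)‖ = ‖v‖ := by
  have hcomp := mfderiv_comp x h₂ h₁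
  have h := norm_mfderiv_of_eq_id (I := I) (f := φ (-t) ∘ φ t)
    (funext fun y => hφ.neg_apply t ht y) x v
  rw [hcomp] at h
  exact h

end Flow

/-! ### The exterior splitting at a point -/

section Algebra

variable {V : Type*} [AddCommGroup V] [Module ℝ V] [FiniteDimensional ℝ V]

/-- Complementary subspaces have an adapted basis. -/
theorem exists_adapted_basis {E F : Submodule ℝ V} (h : IsCompl E F) :
    ∃ (m n : ℕ) (b : Module.Basis (Fin n) ℝ V), E = Submodule.span ℝ (b '' {i | i.val < m}) ∧
      F = Submodule.span ℝ (b '' {i | ¬ i.val < m}) := by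
  have hspan : ∀ S : Submodule ℝ V,
      Submodule.span ℝ (range fun i => (Module.finBasis ℝ S i : V)) = S := by
    intro S
    have := congrArg (Submodule.map S.subtype) (Module.finBasis ℝ S).span_eq
    rwa [Submodule.map_span, ← range_comp, Submodule.map_top, Submodule.range_subtype] at this
  obtain ⟨b, -, hb⟩ := exists_basis_append h
    ((Module.finBasis ℝ E).linearIndependent.map' E.subtype E.ker_subtype)
    ((Module.finBasis ℝ F).linearIndependent.map' F.subtype F.ker_subtype) (hspan E) (hspan F)
  exact ⟨_, _, b, hb⟩

theorem isCompl_mixedSub_wedgeSub {E F : Submodule ℝ V} (h : IsCompl E F) (k : ℕ) :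
    IsCompl (mixedSub k E F) (wedgeSub k F) := by
  obtain ⟨m, n, b, hbE, hbF⟩ := exists_adapted_basis h
  have hcompl : {s : Set.powersetCard (Fin n) k | ∀ i ∈ s, ¬ i.val < m} = {s | ∃ i ∈ s, i.val < m}ᶜ := by
    ext s
    simp
  rw [hbE, hbF, mixedSub_span_basis, wedgeSub_span_basis, ← exteriorPower.coe_basis, hcompl]
  constructor
  · exact (b.exteriorPower k).linearIndependent.disjoint_span_image disjoint_compl_right
  · rw [codisjoint_iff, ← Submodule.span_union, ← image_union, union_compl_self, image_univ]
    exact (b.exteriorPower k).span_eq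

theorem wedgeSub_ne_bot {F : Submodule ℝ V} {k : ℕ} (hF : Module.finrank ℝ F = k) :
    wedgeSub k F ≠ ⊥ := by
  let f := Module.finBasisOfFinrankEq ℝ F hF
  have hli : LinearIndependent ℝ fun i => (f i : V) :=
    f.linearIndependent.map' F.subtype F.ker_subtype
  rw [Submodule.ne_bot_iff]
  exact ⟨_, Submodule.subset_span ⟨_, fun i => (f i).2, rfl⟩, ιMulti_ne_zero hli⟩

theorem mixedSub_ne_bot_iff {E F : Submodule ℝ V} (h : IsCompl E F) {k : ℕ} (hk : 1 ≤ k)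
    (hF : Module.finrank ℝ F = k) : mixedSub k E F ≠ ⊥ ↔ E ≠ ⊥ := by
  constructor
  · rintro hne rfl
    refine hne ?_
    rw [mixedSub, Submodule.span_eq_bot]
    rintro _ ⟨v, -, ⟨i, hi⟩, rfl⟩
    exact AlternatingMap.map_coord_zero _ i ((Submodule.mem_bot ℝ).mp hi)
  · intro hE
    obtain ⟨e, he, he0⟩ := (Submodule.ne_bot_iff E).mp hE
    let f := Module.finBasisOfFinrankEq ℝ F hF
    have hf : LinearIndependent ℝ fun i => (f i : V) :=
      f.linearIndependent.map' F.subtype F.ker_subtype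
    let i₀ : Fin k := ⟨0, hk⟩
    -- Exchange the first basis vector of `F` for `e`; the result is still independent, so its
    -- exterior product is nonzero.
    let g : Fin k → Unit ⊕ Fin k := fun i => if i = i₀ then Sum.inl () else Sum.inr i
    have hg : Function.Injective g := by
      intro i j hij
      simp only [g] at hij
      split_ifs at hij with hi hj
      · rw [hi, hj]
      · exact Sum.inr.inj hij
    have hli : LinearIndependent ℝ (Sum.elim (fun _ : Unit => e) fun i => (f i : V)) := by
      refine (linearIndependent_unique_iff.mpr he0).sum_type hf
        (h.disjoint.mono ?_ ?_) <;> rw [Submodule.span_le]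
      · rintro _ ⟨_, rfl⟩
        exact he
      · rintro _ ⟨i, rfl⟩
        exact (f i).2
    rw [Submodule.ne_bot_iff]
    refine ⟨_, Submodule.subset_span ⟨_, fun i => ?_, ⟨i₀, ?_⟩, rfl⟩,
      ιMulti_ne_zero (hli.comp g hg)⟩
    · rw [Function.comp_apply]
      rcases g i with u | j
      · exact Or.inl he
      · exact Or.inr (f j).2
    · simpa [g] using he

end Algebra

/-! ### Volume expansion as uniform expansion of a line bundle -/

section Cocycle

variable {M : Type*} {G G' : M → Type*}
  [∀ x, NormedAddCommGroup (G x)] [∀ x, InnerProductSpace ℝ (G x)]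
  [∀ x, FiniteDimensional ℝ (G x)]
  [∀ x, NormedAddCommGroup (G' x)] [∀ x, InnerProductSpace ℝ (G' x)]
  [∀ x, FiniteDimensional ℝ (G' x)]

theorem volumeExpanding_iff_uniformlyExpanded {φ : ℝ → M → M}
    {A : ∀ (t : ℝ) (x : M), G x →ₗ[ℝ] G (φ t x)}
    {A' : ∀ (t : ℝ) (x : M), G' x →ₗ[ℝ] G' (φ t x)} {Γ : Set M}
    {F : ∀ x, Submodule ℝ (G x)} {F' : ∀ x, Submodule ℝ (G' x)}
    (h : ∀ x ∈ Γ, ∀ t : ℝ, 0 ≤ t →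
      restrictNorm (A' (-t) (φ t x)) (F' (φ t x)) * absDetOn (A t x) (F x) = 1)
    (h0 : ∀ x ∈ Γ, absDetOn (A 0 x) (F x) = 1) :
    VolumeExpanding φ A Γ F ↔ UniformlyExpanded φ A' Γ F' := by
  constructor
  · rintro ⟨C, hC, lam, hlam, hvol⟩
    -- Volume expansion is silent at t = 0, where the norm is 1; the maximum with 1 covers this
    -- case.
    refine ⟨max C⁻¹ 1, by positivity, lam, hlam, fun x hx t ht => ?_⟩
    have hx1 := h x hx t ht
    rcases ht.eq_or_lt with rfl | ht'
    · rw [h0 x hx, mul_one] at hx1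
      rw [hx1]
      simp
    · have hv := hvol x hx t ht'
      have hpos : 0 < C * Real.exp (lam * t) := by positivity
      rw [eq_inv_of_mul_eq_one_left hx1]
      calc (absDetOn (A t x) (F x))⁻¹ ≤ (C * Real.exp (lam * t))⁻¹ := by gcongr
        _ = C⁻¹ * Real.exp (-lam * t) := by rw [mul_inv, ← Real.exp_neg, neg_mul]
        _ ≤ _ := by gcongr; exact le_max_left _ _
  · rintro ⟨C, hC, lam, hlam, hexp⟩
    -- Halving turns the weak inequality into the strict one.
    refine ⟨C⁻¹ / 2, by positivity, lam, hlam, fun x hx t ht => ?_⟩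
    have hx1 := h x hx t ht.le
    have he := hexp x hx t ht.le
    have hρ : 0 < restrictNorm (A' (-t) (φ t x)) (F' (φ t x)) :=
      lt_of_le_of_ne (restrictNorm_nonneg _ _) fun h' => by
        rw [← h', zero_mul] at hx1
        exact zero_ne_one hx1
    rw [eq_inv_of_mul_eq_one_right hx1]
    calc C⁻¹ / 2 * Real.exp (lam * t) < C⁻¹ * Real.exp (lam * t) := by
          gcongr
          exact half_lt_self (by positivity)
      _ = (C * Real.exp (-lam * t))⁻¹ := by rw [mul_inv, ← Real.exp_neg, neg_mul, neg_neg]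
      _ ≤ _ := by gcongr

end Cocycle

/-! ### The two equivalences -/

theorem lemma3
    {V : Type*} [NormedAddCommGroup V] [NormedSpace ℝ V] [FiniteDimensional ℝ V]
    {H : Type*} [TopologicalSpace H] (I : ModelWithCorners ℝ V H)
    {M : Type*} [TopologicalSpace M] [ChartedSpace H M] [IsManifold I ∞ M]
    [RiemannianBundle (fun x : M => TangentSpace I x)]
    [IsContMDiffRiemannianBundle I ∞ V (fun x : M => TangentSpace I x)]
    (X : ∀ x : M, TangentSpace I x)
    (hX : ContMDiff I I.tangent 1 (fun x => (⟨x, X x⟩ : TangentBundle I M)))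
    (φ : ℝ → M → M) (hφ : IsFlowOf I X φ)
    (Γ : Set M) (hΓ : IsCompact Γ) (hΓφ : ∀ t : ℝ, φ t '' Γ = Γ)
    (k : ℕ) (hk : 1 ≤ k)
    (E F : ∀ x : M, Submodule ℝ (TangentSpace I x))
    (hEF : IsInvariantSplitting (IsContVectorField I) φ (derivCocycle I φ) Γ E F)
    (hF : ∀ x ∈ Γ, Module.finrank ℝ (F x) = k) :
    (VolumeExpanding φ (derivCocycle I φ) Γ F ↔
      UniformlyExpanded φ (wedgeCocycle I k φ) Γ (fun x => wedgeSub k (F x))) ∧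
    (UniformlyContracted φ (derivCocycle I φ) Γ E →
      (IsSingularHyperbolic (IsContVectorField I) φ (derivCocycle I φ) Γ E F ↔
        IsPartiallyHyperbolic (IsContMultivectorField I k) φ (wedgeCocycle I k φ) Γ
            (fun x => mixedSub k (E x) (F x)) (fun x => wedgeSub k (F x)) ∧
          UniformlyExpanded φ (wedgeCocycle I k φ) Γ (fun x => wedgeSub k (F x)))) := by
  have hmem : ∀ x ∈ Γ, ∀ t, φ t x ∈ Γ := fun x hx t => hΓφ t ▸ mem_image_of_mem _ hx
  have hF0 : ∀ x ∈ Γ, F x ≠ ⊥ := by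
    intro x hx h
    have := hF x hx
    rw [h, finrank_bot] at this
    omega
  -- Differentiability along Γ, for both signs of t, comes from the invariance of `F`, which is
  -- nonzero because k ≥ 1.
  have hdiff : ∀ x ∈ Γ, ∀ t, MDifferentiableAt I I (φ t) x := fun x hx t =>
    mdifferentiableAt_of_map_ne_bot (F := F x)
      (by rw [hEF.map_right x hx t]; exact hF0 _ (hmem x hx t))
  have hiso : ∀ x ∈ Γ, ∀ t : ℝ, 0 ≤ t → ∀ v,
      ‖derivCocycle I φ (-t) (φ t x) (derivCocycle I φ t x v)‖ = ‖v‖ := fun x hx t ht =>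
    norm_derivCocycle_neg hφ ht (hdiff x hx t) (hdiff _ (hmem x hx t) _)
  have hdet : ∀ x ∈ Γ, ∀ t : ℝ, 0 ≤ t →
      restrictNorm (wedgeCocycle I k φ (-t) (φ t x)) (wedgeSub k (F (φ t x))) *
        absDetOn (derivCocycle I φ t x) (F x) = 1 := by
    intro x hx t ht
    rw [← hEF.map_right x hx t]
    exact restrictNorm_wedgeSub_mul_absDetOn (hF x hx) fun v _ => hiso x hx t ht v
  have hdet0 : ∀ x ∈ Γ, absDetOn (derivCocycle I φ 0 x) (F x) = 1 := fun x _ =>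
    absDetOn_eq_one fun v _ => norm_mfderiv_of_eq_id (funext hφ.zero) x v
  have hvol := volumeExpanding_iff_uniformlyExpanded (A' := wedgeCocycle I k φ)
    (F' := fun x => wedgeSub k (F x)) hdet hdet0
  have hcompl : ∀ x ∈ Γ, IsCompl (E x) (F x) := hEF.isCompl
  have : IsContinuousRiemannianBundle V (fun x : M => TangentSpace I x) := by
    obtain ⟨g, hg, hg'⟩ :=
      IsContMDiffRiemannianBundle.exists_contMDiff (IB := I) (n := ∞) (F := V)
        (E := fun x : M => TangentSpace I x)
    exact ⟨g, hg.continuous, hg'⟩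
  obtain ⟨c, hc0, hc⟩ := exists_angle_bound hΓ hEF.continuous_left hEF.continuous_right hcompl
  have hinv : IsInvariantSplitting (IsContMultivectorField I k) φ (wedgeCocycle I k φ) Γ
      (fun x => mixedSub k (E x) (F x)) (fun x => wedgeSub k (F x)) :=
    { isCompl := fun x hx => isCompl_mixedSub_wedgeSub (hcompl x hx) k
      continuous_left :=
        isContSubbundle_mixedSub hEF.continuous_left hEF.continuous_right hcompl k
      continuous_right :=
        isContSubbundle_wedgeSub hEF.continuous_left hEF.continuous_right hcompl k
      map_left := fun x hx t => by
        rw [← hEF.map_left x hx t, ← hEF.map_right x hx t]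
        exact map_mixedSub _ _ _ _
      map_right := fun x hx t => by
        rw [← hEF.map_right x hx t]
        exact map_wedgeSub _ _ _ }
  -- The core of (2): both dominations hold together, with the same rate `lam`.
  have hsplit : IsDominatedSplitting (IsContVectorField I) φ (derivCocycle I φ) Γ E F ↔
      IsDominatedSplitting (IsContMultivectorField I k) φ (wedgeCocycle I k φ) Γ
        (fun x => mixedSub k (E x) (F x)) (fun x => wedgeSub k (F x)) := by
    constructor
    · intro h
      obtain ⟨K, hK, lam, hlam, hdom⟩ := h.dominated
      refine ⟨hinv, fun x hx => ?_, fun x hx => ?_, ?_⟩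
      · exact (mixedSub_ne_bot_iff (hcompl x hx) hk (hF x hx)).mpr (h.left_ne_bot x hx)
      · exact wedgeSub_ne_bot (hF x hx)
      · set N : ℝ := ((Module.finrank ℝ V).choose k : ℝ)
        set B : ℝ := N * (N * (k.factorial * (1 + c) ^ k)) * √(k.factorial : ℝ) * (max K 1) ^ k
        have hB : 0 ≤ B := by positivity
        -- The added 1 makes the inequality strict; L = max K 1 meets the requirement L ≥ 1 of the
        -- exchange estimate.
        refine ⟨B + 1, by positivity, lam, hlam, fun x hx t ht => ?_⟩
        have hd := hdom x hx t ht
        rw [← hEF.map_right x hx t] at hd ⊢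
        have hle := restrictNorm_mixedSub_mul_le (T := derivCocycle I φ t x)
          (S := derivCocycle I φ (-t) (φ t x)) (hcompl x hx) hc0.le (hc x hx) (hF x hx)
          (fun v _ => hiso x hx t ht.le v) (L := max K 1) (r := Real.exp (-lam * t))
          (le_max_right _ _) (Real.exp_pos _).le
          (Real.exp_le_one_iff.mpr (by nlinarith))
          (hd.le.trans (by gcongr; exact le_max_left _ _))
        refine hle.trans_lt ?_
        have he := Real.exp_pos (-lam * t)
        have : Module.finrank ℝ (TangentSpace I x) = Module.finrank ℝ V := rfl
        rw [this]
        change B * _ < _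
        gcongr
        linarith
    · intro h
      obtain ⟨K, hK, lam, hlam, hdom⟩ := h.dominated
      refine ⟨hEF, fun x hx => ?_, hF0, ?_⟩
      · exact (mixedSub_ne_bot_iff (hcompl x hx) hk (hF x hx)).mp (h.left_ne_bot x hx)
      · have hB : 0 < k * c * √(k.factorial : ℝ) := by
          have : (0 : ℝ) < k := by exact_mod_cast hk
          positivity
        refine ⟨k * c * √(k.factorial : ℝ) * K, by positivity, lam, hlam, fun x hx t ht => ?_⟩
        have hd := hdom x hx t ht
        -- The angle is needed at the endpoint `φ t x`, since the exterior product being bounded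
        -- below consists of images under T.
        have hcx := hc _ (hmem x hx t)
        rw [← hEF.map_left x hx t, ← hEF.map_right x hx t] at hcx
        rw [← hEF.map_right x hx t] at hd ⊢
        have hle := restrictNorm_mul_le_mixedSub (T := derivCocycle I φ t x)
          (S := derivCocycle I φ (-t) (φ t x)) hc0.le hcx hk (hF x hx)
          (fun v _ => hiso x hx t ht.le v)
        refine hle.trans_lt ?_
        rw [mul_assoc _ K]
        exact mul_lt_mul_of_pos_left hd hB
  refine ⟨hvol, fun hcontr => ⟨?_, ?_⟩⟩
  · rintro ⟨hdom, -, hv⟩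
    exact ⟨⟨hsplit.mp hdom, Or.inr (hvol.mp hv)⟩, hvol.mp hv⟩
  · rintro ⟨⟨hdom, -⟩, hu⟩
    exact ⟨hsplit.mpr hdom, hcontr, hvol.mpr hu⟩
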